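/- **Definitions.** Let $(X,d)$ be a compact metric space. For a continuous $f\colon X\to X$ and a continuous $\phi\colon X\to\mathbb R$, let $\mathcal M(X,f)$ be the set of $f$-invariant Borel probability measures, $Q(f,\phi)=\sup\{\int\phi\,d\mu:\mu\in\mathcal M(X,f)\}$, and $\mathcal M_{\max}(f,\phi)=\{\mu\in\mathcal M(X,f):\int\phi\,d\mu=Q(f,\phi)\}$. Let $\Omega(f)$ be the nonwandering set of $f$, i.e. the set of $x$ such that every open $V\ni x$ satisfies $V\cap f^{-n}(V)\ne\emptyset$ for some $n\ge 1$. For a finite nonempty set $\mathcal O$ let $\mu_{\mathcal O}=\frac1{\operatorname{card}\mathcal O}\sum_{x\in\mathcal O}\delta_x$. Let $\operatorname{LIP}(f)=\sup_{x\neq y} d(f(x),f(y))/d(x,y)$ and $|\phi|_\alpha=\sup_{x\ne y}|\phi(x)-\phi(y)|/d(x,y)^\alpha$. For a map $h\colon A\to X$, $A\subseteq X$, let $d_\infty(h,\mathrm{id})=\sup_{x\in A}d(h(x),x)$. Let $\mathcal F$ be a set of Lipschitz self-maps of $X$ equipped with a topology. For $f,g\in\mathcal F$ and $\varepsilon>0$,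 an *$\varepsilon$-intertwining pair* for $(f,g)$ is a pair of (not necessarily continuous) maps $h\colon\Omega(f)\to\Omega(g)$, $i\colon\Omega(g)\to\Omega(f)$ with $h\circ f=g\circ h$, $i\circ g=f\circ i$, $d_\infty(h,\mathrm{id})<\varepsilon$ and $d_\infty(i,\mathrm{id})<\varepsilon$. A map $f\in\mathcal F$ is *$\mathcal F$-stably hyperbolic* if: * **(IS)** for every $\varepsilon>0$ there is a neighbourhood $U$ of $f$ in $\mathcal F$ such that for every $g\in U$, $\operatorname{LIP}(g)<2\operatorname{LIP}(f)$ and there exists an $\varepsilon$-intertwining pair $(h_g,i_g)$ for $(f,g)$; * **(RHE)** there are a neighbourhood $U$ of $f$ and constants $K>0$, $\delta>0$, $\lambda>1$ such that for all $g\in U$, $x,y\in\Omega(g)$ and integers $n\ge1$: if $\max_{0\le m\le n}d(g^m(x),g^m(y))<\delta$, then $d(g^m(x),g^m(y))\le K\lambda^{-\min\{m,n-m\}}\bigl(d(x,y)+d(g^n(x),g^n(y))\bigr)$ for all $0\le m\le n$; * **(ML)** for every $\alpha\in(0,1]$ there is $L>0$ such that for every $\alpha$-Hölder $\phi\colon X\to\mathbb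 R$ there is an $\alpha$-Hölder $u\colon\Omega(f)\to\mathbb R$ with $\phi+u-u\circ f\le Q(f,\phi)$ on $\Omega(f)$ and $|u|_\alpha\le L|\phi|_\alpha$. **Theorem (Joint perturbation for $C^1$ potentials).** Let $M$ be a compact connected smooth manifold without boundary, with a Riemannian metric and its induced distance $d$, and let $\mathcal F$ be a set of Lipschitz self-maps of $M$ equipped with a topology. Let $f\in\mathcal F$ be $\mathcal F$-stably hyperbolic and let $\mathcal O$ be an $f$-periodic orbit. Then there exist a neighbourhood $U$ of $f$ in $\mathcal F$ and constants $C>0$, $\varepsilon>0$ such that for every $g\in U$: 1. there exists an $\varepsilon$-intertwining pair $(h_g,i_g)$ for $(f,g)$; 2. for every $\varepsilon$-intertwining pair $(h_g,i_g)$ for $(f,g)$, writing $\mathcal O_g=h_g(\mathcal O)$ and $d_g=\max\{d_\infty(h_g,\mathrm{id}),d_\infty(i_g,\mathrm{id})\}$, there exists $v_g\in C^1(M,\mathbb R)$ such that $$\|Dv_g\|_\infty\le 3C\,d_g^{1/2}\quad\text{and}\quad \mu_{\mathcal O_g}\in\mathcal M_{\max}(g,v_g),$$ and for every $\phi\in C^1(M,\mathbb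 R)$ with $\mathcal M_{\max}(f,\phi)=\{\mu_{\mathcal O}\}$, $$\mathcal M_{\max}\bigl(g,\phi+\|D\phi\|_\infty v_g\bigr)=\{\mu_{\mathcal O_g}\}.$$ Here $\|D\phi\|_\infty=\sup_{x\in M}\|D\phi(x)\|$, with the norm dual to the Riemannian norm on $T_xM$. -/

import Mathlib

open Set Filter Topology MeasureTheory Manifold Bundle
open scoped NNReal ENNReal ContDiff

noncomputable section

/-! ### Invariant and maximizing measures -/

section Measures

variable {X : Type*} [MeasurableSpace X]

/-- The set `𝓜(X, f)` of `f`-invariant (Borel) probability measures. -/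
def invariantMeasures (f : X → X) : Set (Measure X) :=
  {μ | IsProbabilityMeasure μ ∧ MeasurePreserving f μ μ}

/-- The maximum ergodic average `Q(f, φ) = sup {∫ φ dμ : μ ∈ 𝓜(X, f)}`. -/
def maxErgodicAverage (f : X → X) (φ : X → ℝ) : ℝ :=
  sSup ((fun μ : Measure X => ∫ x, φ x ∂μ) '' invariantMeasures f)

/-- The set of `(f, φ)`-maximizing measures. -/
def maximizingMeasures (f : X → X) (φ : X → ℝ) : Set (Measure X) :=
  {μ | μ ∈ invariantMeasures f ∧ ∫ x, φ x ∂μ = maxErgodicAverage f φ}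

/-- The measure `μ_O = (1 / card O) ∑_{x ∈ O} δ_x`, for a finite set `O`. -/
def orbitMeasure (O : Set X) : Measure X :=
  (O.ncard : ℝ≥0∞)⁻¹ • ∑ᶠ x ∈ O, Measure.dirac x

end Measures

/-- `O` is a periodic orbit of `f`: the forward orbit of a periodic point. -/
def IsPeriodicOrbit {X : Type*} (f : X → X) (O : Set X) : Prop :=
  ∃ x : X, (∃ p : ℕ, 0 < p ∧ f^[p] x = x) ∧ O = range fun k : ℕ => f^[k] x

/-! ### The nonwandering set -/

section Nonwandering

variable {X : Type*} [TopologicalSpace X]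

/-- The nonwandering set `Ω(f)`. -/
def nonwanderingSet (f : X → X) : Set X :=
  {x | ∀ V : Set X, IsOpen V → x ∈ V → ∃ n : ℕ, 1 ≤ n ∧ (V ∩ f^[n] ⁻¹' V).Nonempty}

theorem map_mem_nonwanderingSet {f : X → X} (hf : Continuous f) {x : X}
    (hx : x ∈ nonwanderingSet f) : f x ∈ nonwanderingSet f := by
  intro V hV hxV
  obtain ⟨n, hn, y, hy, hy'⟩ := hx (f ⁻¹' V) (hV.preimage hf) hxV
  refine ⟨n, hn, f y, hy, ?_⟩
  rw [mem_preimage, ← Function.iterate_succ_apply, Function.iterate_succ_apply']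
  exact hy'

end Nonwandering

/-! ### Spaces of Lipschitz self-maps and stable hyperbolicity -/

/-- The elements of `𝓕` are Lipschitz self-maps of `X`. -/
class LipschitzSelfMapClass (𝓕 : Type*) (X : Type*) [PseudoEMetricSpace X] [FunLike 𝓕 X X] :
    Prop where
  exists_lipschitzWith : ∀ f : 𝓕, ∃ K : ℝ≥0, LipschitzWith K f

/-- `LIP(f)`, the supremum of `d(f x, f y) / d(x, y)` over `x ≠ y`. -/
def lipConst {X : Type*} [MetricSpace X] (f : X → X) : ℝ :=
  sSup {r : ℝ | ∃ x y : X, x ≠ y ∧ r = dist (f x) (f y) / dist x y}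

/-- For a subset `A` of `X` and a map `h` from `A` to `B ⊆ X`, the uniform distance
`d_∞(h, id) = sup {d(h x, x) : x ∈ A}`. -/
def distToId {X : Type*} [MetricSpace X] {A B : Set X} (h : A → B) : ℝ :=
  ⨆ x : A, dist (h x : X) (x : X)

section StablyHyperbolic

variable {X : Type*} [MetricSpace X] {𝓕 : Type*} [FunLike 𝓕 X X] [LipschitzSelfMapClass 𝓕 X]

/-- The restriction `f : Ω(f) → Ω(f)`. -/
def restrictNonwandering (f : 𝓕) (x : nonwanderingSet f) : nonwanderingSet f :=
  ⟨f x, map_mem_nonwanderingSet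
    (LipschitzSelfMapClass.exists_lipschitzWith f).choose_spec.continuous x.2⟩

/-- The maps `h : Ω(f) → Ω(g)` and `i : Ω(g) → Ω(f)` intertwine `f` and `g`, and both are
`ε`-close to the identity. No continuity of `h` and `i` is required. -/
structure IsIntertwining (f g : 𝓕) (ε : ℝ) (h : nonwanderingSet f → nonwanderingSet g)
    (i : nonwanderingSet g → nonwanderingSet f) : Prop where
  comp_h : h ∘ restrictNonwandering f = restrictNonwandering g ∘ h
  comp_i : i ∘ restrictNonwandering g = restrictNonwandering f ∘ i
  dist_h : distToId h < ε
  dist_i : distToId i < ε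

variable [TopologicalSpace 𝓕]

/-- Intertwining stability. -/
def IntertwiningStable (f : 𝓕) : Prop :=
  ∀ ε : ℝ, 0 < ε → ∃ U ∈ 𝓝 f, ∀ g ∈ U, lipConst g < 2 * lipConst f ∧
    ∃ (h : nonwanderingSet f → nonwanderingSet g) (i : nonwanderingSet g → nonwanderingSet f),
      IsIntertwining f g ε h i

/-- Robust hyperbolic estimates. -/
def RobustHyperbolicEstimates (f : 𝓕) : Prop :=
  ∃ U ∈ 𝓝 f, ∃ K δ lam : ℝ, 0 < K ∧ 0 < δ ∧ 1 < lam ∧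
    ∀ g ∈ U, ∀ x ∈ nonwanderingSet g, ∀ y ∈ nonwanderingSet g, ∀ n : ℕ, 1 ≤ n →
      (∀ m ≤ n, dist ((⇑g)^[m] x) ((⇑g)^[m] y) < δ) →
      ∀ m ≤ n, dist ((⇑g)^[m] x) ((⇑g)^[m] y) ≤
        K * (lam ^ min m (n - m))⁻¹ * (dist x y + dist ((⇑g)^[n] x) ((⇑g)^[n] y))

/-- The Mañé lemma, with uniform control of the Hölder seminorm. -/
def ManeLemma [MeasurableSpace X] (f : 𝓕) : Prop :=
  ∀ α : ℝ≥0, 0 < α → α ≤ 1 → ∃ L : ℝ≥0, 0 < L ∧ ∀ φ : X → ℝ, MemHolder α φ →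
    ∃ u : nonwanderingSet f → ℝ, MemHolder α u ∧
      (∀ x : nonwanderingSet f,
        φ x + u x - u (restrictNonwandering f x) ≤ maxErgodicAverage f φ) ∧
      nnHolderNorm α u ≤ L * nnHolderNorm α φ

/-- `f` is `𝓕`-stably hyperbolic. -/
structure StablyHyperbolic [MeasurableSpace X] (f : 𝓕) : Prop where
  intertwiningStable : IntertwiningStable f
  robustHyperbolicEstimates : RobustHyperbolicEstimates f
  maneLemma : ManeLemma f

end StablyHyperbolic

/-! ### `C¹` functions on a Riemannian manifold -/

/-- `‖Dφ‖_∞`, the supremum over `x` of the norm of the derivative `Dφ(x)` as a linear form on the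
tangent space at `x` with the Riemannian norm. -/
def supNormDeriv {n : ℕ} {M : Type*} [TopologicalSpace M]
    [ChartedSpace (EuclideanSpace ℝ (Fin n)) M]
    [RiemannianBundle (fun x : M => TangentSpace (𝓡 n) x)] (φ : M → ℝ) : ℝ :=
  ⨆ x : M, ‖mfderiv (𝓡 n) 𝓘(ℝ, ℝ) φ x‖

end

/-!
Write `d` for the larger of the distances of `h` and `i` to the identity, `O_g = h(O)`, and `N`
for the Lipschitz constant `‖Dφ‖_∞` of `φ`. The perturbation is `v = -2 a √d w`, where `a` is a
large constant and `w` is a `C¹` function which vanishes exactly on `O_g` and dominates a multiple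
of the distance to `O_g` at distances beyond `√d` (`exists_contMDiff_softDist`). It is built from
softened Euclidean distances in an embedding of `M` whose inverse is Lipschitz
(`exists_contMDiff_dist_le`).

The Mañé lemma gives a Lipschitz sub-action `u` for `(f, φ)`. Since `i` intertwines `g` and `f`,
the function `u ∘ i` is a sub-action for `(g, φ)` on `Ω(g)` up to an error of order `N d` per
step, which the penalty `N a √d w` compensates as long as the orbit is at distance at least `√d`
from `O_g`. While an orbit stays close to `O_g`, it shadows `O_g` in phase, and the hyperbolic
estimates bound the total cost by a multiple of `N √d`; to start a new such stretch, the orbit has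
to reach a definite distance from `O_g` first, where the penalty repays this cost
(`sum_le_of_excursions`, `sum_iterate_le_of_hyperbolic`). Hence `∫ φ dμ - N a √d ∫ w dμ` is at
most the average of `φ` over `O_g` for all `g`-invariant `μ` (`integral_sub_le_of_intertwining`).
As `v` contains the penalty twice, a maximizing measure for `φ + N v` has `∫ w dμ = 0` if `N > 0`,
so it is carried by `O_g`.

If `N = 0`, the perturbation is absent and `f` is uniquely ergodic, so the estimate holds for
every potential. Taking `φ = w` shows that `∫ w dμ = 0` for all `g`-invariant `μ`, because the
penalty is smaller than `w`. If `d = 0`, then `f` and `g` have the same invariant measures.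
-/

/-! ### Lipschitz estimates on Riemannian manifolds -/

section Manifolds

variable {n : ℕ} {M : Type*} [MetricSpace M]
  [ChartedSpace (EuclideanSpace ℝ (Fin n)) M]
  [RiemannianBundle (fun x : M => TangentSpace (𝓡 n) x)]

section

attribute [local instance] normedAddCommGroupTangentSpaceVectorSpace
  normedSpaceTangentSpaceVectorSpace

variable {V : Type*} [NormedAddCommGroup V] [NormedSpace ℝ V]

/-- Mean value inequality on a Riemannian manifold, by integrating along almost minimizing paths. -/
theorem norm_sub_le_of_norm_mfderiv_apply_le [IsRiemannianManifold (𝓡 n) M] {F : M → V} {B : ℝ}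
    (hB : 0 ≤ B) (hF : ContMDiff (𝓡 n) 𝓘(ℝ, V) 1 F)
    (h : ∀ (x : M) (ξ : TangentSpace (𝓡 n) x),
      ‖(mfderiv (𝓡 n) 𝓘(ℝ, V) F x ξ : V)‖ ≤ B * ‖ξ‖) (x y : M) :
    ‖F y - F x‖ ≤ B * dist x y := by
  lift B to ℝ≥0 using hB
  suffices H : ∀ r : ℝ, dist x y < r → ‖F y - F x‖ ≤ B * r by
    have ht : Tendsto (fun k : ℕ => B * (dist x y + 1 / ((k : ℝ) + 1))) atTop
        (𝓝 (B * (dist x y + 0))) :=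
      (tendsto_one_div_add_atTop_nhds_zero_nat.const_add _).const_mul _
    rw [add_zero] at ht
    exact ge_of_tendsto' ht fun k => H _ (lt_add_of_pos_right _ (by positivity))
  intro r hr
  have hr0 : 0 < r := dist_nonneg.trans_lt hr
  have hr' : Manifold.riemannianEDist (𝓡 n) x y < ENNReal.ofReal r := by
    rw [← IsRiemannianManifold.out (I := 𝓡 n) x y, edist_dist]
    exact (ENNReal.ofReal_lt_ofReal_iff hr0).2 hr
  obtain ⟨γ, hγx, hγy, γ_smooth, hγ, -⟩ :=
    exists_lt_locally_constant_of_riemannianEDist_lt hr' zero_lt_one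
  suffices H : ‖F y - F x‖ₑ ≤ B * ENNReal.ofReal r by
    rw [← ofReal_norm, ← ENNReal.ofReal_coe_nnreal, ← ENNReal.ofReal_mul (by positivity)] at H
    exact (ENNReal.ofReal_le_ofReal_iff (by positivity)).1 H
  have hγ' : ContDiff ℝ 1 (F ∘ γ) := by
    rw [← contMDiff_iff_contDiff]; exact hF.comp γ_smooth
  calc ‖F y - F x‖ₑ = ‖(F ∘ γ) 1 - (F ∘ γ) 0‖ₑ := by simp [hγx, hγy]
    _ ≤ ∫⁻ t in Icc (0:ℝ) 1, ‖derivWithin (F ∘ γ) (Icc 0 1) t‖ₑ :=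
      enorm_sub_le_lintegral_derivWithin_Icc_of_contDiffOn_Icc hγ'.contDiffOn zero_le_one
    _ ≤ ∫⁻ t in Icc (0:ℝ) 1, B * ‖mfderiv 𝓘(ℝ, ℝ) (𝓡 n) γ t 1‖ₑ := by
      apply setLIntegral_mono' measurableSet_Icc (fun t ht ↦ ?_)
      rw [(hγ'.differentiable one_ne_zero t).derivWithin (uniqueDiffOn_Icc zero_lt_one t ht)]
      have hc : mfderiv 𝓘(ℝ, ℝ) 𝓘(ℝ, V) (F ∘ γ) t =
          (mfderiv (𝓡 n) 𝓘(ℝ, V) F (γ t)) ∘L (mfderiv 𝓘(ℝ, ℝ) (𝓡 n) γ t) :=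
        mfderiv_comp t (hF.mdifferentiable one_ne_zero _)
          (γ_smooth.mdifferentiable one_ne_zero _)
      have hd : deriv (F ∘ γ) t =
          mfderiv (𝓡 n) 𝓘(ℝ, V) F (γ t) (mfderiv 𝓘(ℝ, ℝ) (𝓡 n) γ t 1) := by
        rw [← fderiv_apply_one_eq_deriv, ← mfderiv_eq_fderiv, hc]; rfl
      rw [hd]
      have := h (γ t) (mfderiv 𝓘(ℝ, ℝ) (𝓡 n) γ t 1)
      have h2 := ENNReal.ofReal_le_ofReal this
      rw [ENNReal.ofReal_mul (by positivity), ENNReal.ofReal_coe_nnreal, ofReal_norm,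
        ofReal_norm] at h2
      exact h2
    _ = B * Manifold.pathELength (𝓡 n) γ 0 1 := by
      rw [lintegral_const_mul' _ _ ENNReal.coe_ne_top,
        Manifold.pathELength_eq_lintegral_mfderiv_Icc]
    _ ≤ B * ENNReal.ofReal r := by gcongr

variable [IsManifold (𝓡 n) ∞ M]
  [IsContMDiffRiemannianBundle (𝓡 n) ∞ (EuclideanSpace ℝ (Fin n))
    (fun x : M => TangentSpace (𝓡 n) x)]

theorem isContinuousRiemannianBundle_tangentSpace :
    IsContinuousRiemannianBundle (EuclideanSpace ℝ (Fin n))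
      (fun x : M => TangentSpace (𝓡 n) x) := by
  obtain ⟨g, hg, h⟩ := IsContMDiffRiemannianBundle.exists_contMDiff (IB := 𝓡 n) (n := ∞)
    (F := EuclideanSpace ℝ (Fin n)) (E := fun x : M => TangentSpace (𝓡 n) x)
  exact ⟨g, hg.continuous, h⟩

/-- The derivative of a `C¹` map on a compact Riemannian manifold is bounded for the Riemannian
norm. Locally it factors through a chart, whose derivative is locally bounded. -/
theorem exists_norm_mfderiv_apply_le [CompactSpace M] {F : M → V}
    (hF : ContMDiff (𝓡 n) 𝓘(ℝ, V) 1 F) :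
    ∃ B : ℝ, 0 < B ∧ ∀ (x : M) (ξ : TangentSpace (𝓡 n) x),
      ‖(mfderiv (𝓡 n) 𝓘(ℝ, V) F x ξ : V)‖ ≤ B * ‖ξ‖ := by
  have := isContinuousRiemannianBundle_tangentSpace (n := n) (M := M)
  have : IsManifold (𝓡 n) 1 M := .of_le (n := ∞) (by simp)
  suffices H : ∃ B : ℝ, 0 < B ∧ ∀ x ∈ (univ : Set M), ∀ (ξ : TangentSpace (𝓡 n) x),
      ‖(mfderiv (𝓡 n) 𝓘(ℝ, V) F x ξ : V)‖ ≤ B * ‖ξ‖ by simpa using H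
  refine isCompact_univ.induction_on (p := fun s => ∃ B : ℝ, 0 < B ∧ ∀ x ∈ s,
    ∀ (ξ : TangentSpace (𝓡 n) x), ‖(mfderiv (𝓡 n) 𝓘(ℝ, V) F x ξ : V)‖ ≤ B * ‖ξ‖)
    ⟨1, one_pos, by simp⟩ ?_ ?_ ?_
  · rintro s t hst ⟨B, hB, h⟩
    exact ⟨B, hB, fun x hx => h x (hst hx)⟩
  · rintro s t ⟨B, hB, h⟩ ⟨B', hB', h'⟩
    refine ⟨max B B', by positivity, ?_⟩
    rintro x (hx | hx) ξ
    · exact (h x hx ξ).trans (by gcongr; exact le_max_left _ _)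
    · exact (h' x hx ξ).trans (by gcongr; exact le_max_right _ _)
  · intro x _
    obtain ⟨C, C_pos, hC⟩ := eventually_norm_mfderiv_extChartAt_lt (𝓡 n) x
    let Fx : EuclideanSpace ℝ (Fin n) → V := F ∘ (extChartAt (𝓡 n) x).symm
    have hFx : ContDiffOn ℝ 1 Fx (extChartAt (𝓡 n) x).target := by
      rw [← contMDiffOn_iff_contDiffOn]
      exact hF.comp_contMDiffOn (contMDiffOn_extChartAt_symm x)
    have hopen : IsOpen (extChartAt (𝓡 n) x).target := isOpen_extChartAt_target x
    have hcont : ContinuousAt (fun y => ‖fderiv ℝ Fx (extChartAt (𝓡 n) x y)‖) x := by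
      refine ContinuousAt.norm ?_
      refine ContinuousAt.comp (g := fderiv ℝ Fx) ?_ (continuousAt_extChartAt x)
      exact (hFx.continuousOn_fderiv_of_isOpen hopen le_rfl).continuousAt
        (hopen.mem_nhds (mem_extChartAt_target x))
    have hlt := hcont.eventually (gt_mem_nhds (lt_add_one _))
    set B := ‖fderiv ℝ Fx (extChartAt (𝓡 n) x x)‖ + 1 with hBdef
    have hB : 0 < B := by positivity
    refine ⟨_, mem_nhdsWithin_of_mem_nhds
      (inter_mem (inter_mem hC hlt) (chart_source_mem_nhds (EuclideanSpace ℝ (Fin n)) x)),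
      B * C, by positivity, ?_⟩
    rintro y ⟨⟨hy1, hy2⟩, hy3⟩ ξ
    have hy3' : y ∈ (extChartAt (𝓡 n) x).source := by simpa using hy3
    have heq : F =ᶠ[𝓝 y] Fx ∘ extChartAt (𝓡 n) x := by
      filter_upwards [(isOpen_extChartAt_source (I := 𝓡 n) x).mem_nhds hy3'] with z hz
      simp only [Fx, Function.comp_apply, (extChartAt (𝓡 n) x).left_inv hz]
    have hd : DifferentiableAt ℝ Fx (extChartAt (𝓡 n) x y) :=
      (hFx.differentiableOn one_ne_zero).differentiableAt
        (hopen.mem_nhds ((extChartAt (𝓡 n) x).map_source hy3'))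
    have hcomp : mfderiv (𝓡 n) 𝓘(ℝ, V) F y =
        (mfderiv 𝓘(ℝ, EuclideanSpace ℝ (Fin n)) 𝓘(ℝ, V) Fx (extChartAt (𝓡 n) x y)) ∘L
          (mfderiv (𝓡 n) 𝓘(ℝ, EuclideanSpace ℝ (Fin n)) (extChartAt (𝓡 n) x) y) := by
      rw [heq.mfderiv_eq]
      exact mfderiv_comp y hd.mdifferentiableAt (mdifferentiableAt_extChartAt hy3)
    have happ : (mfderiv (𝓡 n) 𝓘(ℝ, V) F y ξ : V) = fderiv ℝ Fx (extChartAt (𝓡 n) x y)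
        (mfderiv (𝓡 n) 𝓘(ℝ, EuclideanSpace ℝ (Fin n)) (extChartAt (𝓡 n) x) y ξ) := by
      rw [hcomp, mfderiv_eq_fderiv]; rfl
    rw [happ]
    refine (ContinuousLinearMap.le_opNorm _ _).trans ?_
    rw [mul_assoc]
    refine mul_le_mul (le_of_lt hy2) ?_ (norm_nonneg _) hB.le
    exact (ContinuousLinearMap.le_opNorm
      (mfderiv (𝓡 n) 𝓘(ℝ, EuclideanSpace ℝ (Fin n)) (extChartAt (𝓡 n) x) y) ξ).trans
      (mul_le_mul_of_nonneg_right (le_of_lt hy1) (norm_nonneg _))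

/-- The inverse of a chart is Lipschitz near the image of the base point, uniformly in both points:
the Riemannian distance is bounded by the length of the image of a segment. -/
theorem exists_edist_le_edist_extChartAt [IsRiemannianManifold (𝓡 n) M] (q : M) :
    ∃ C : ℝ≥0, ∀ᶠ p : M × M in 𝓝 q ×ˢ 𝓝 q,
      edist p.1 p.2 ≤ C * edist (extChartAt (𝓡 n) q p.1) (extChartAt (𝓡 n) q p.2) := by
  have := isContinuousRiemannianBundle_tangentSpace (n := n) (M := M)
  have : IsManifold (𝓡 n) 1 M := .of_le (n := ∞) (by simp)
  obtain ⟨C, C_pos, hC⟩ := eventually_norm_mfderivWithin_symm_extChartAt_lt (𝓡 n) q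
  lift C to ℝ≥0 using le_of_lt C_pos
  have hC' : ∀ᶠ y in 𝓝[range (𝓡 n)] (extChartAt (𝓡 n) q q), ∀ ξ : EuclideanSpace ℝ (Fin n),
      ‖mfderivWithin 𝓘(ℝ, EuclideanSpace ℝ (Fin n)) (𝓡 n) (extChartAt (𝓡 n) q).symm
        (range (𝓡 n)) y ξ‖ ≤ C * ‖ξ‖ := by
    filter_upwards [hC] with y hy ξ
    exact (ContinuousLinearMap.le_opNorm (mfderivWithin 𝓘(ℝ, EuclideanSpace ℝ (Fin n)) (𝓡 n)
      (extChartAt (𝓡 n) q).symm (range (𝓡 n)) y) ξ).trans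
      (mul_le_mul_of_nonneg_right hy.le (norm_nonneg _))
  refine ⟨C, ?_⟩
  -- a ball in the chart, convex, on which the derivative of the inverse chart is bounded
  obtain ⟨r, r_pos, hr⟩ : ∃ r > 0,
      Metric.ball (extChartAt (𝓡 n) q q) r ∩ range (𝓡 n) ⊆ (extChartAt (𝓡 n) q).target ∩
        {y | ∀ ξ : EuclideanSpace ℝ (Fin n),
          ‖mfderivWithin 𝓘(ℝ, EuclideanSpace ℝ (Fin n)) (𝓡 n) (extChartAt (𝓡 n) q).symm
            (range (𝓡 n)) y ξ‖ ≤ C * ‖ξ‖} :=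
    Metric.mem_nhdsWithin_iff.1 (inter_mem (extChartAt_target_mem_nhdsWithin q) hC')
  have A : (extChartAt (𝓡 n) q) ⁻¹' (Metric.ball (extChartAt (𝓡 n) q q) r ∩ range (𝓡 n)) ∈ 𝓝 q := by
    apply extChartAt_preimage_mem_nhds_of_mem_nhdsWithin (by simp)
    rw [inter_comm]
    exact inter_mem_nhdsWithin _ (Metric.ball_mem_nhds _ r_pos)
  have A' := inter_mem A (chart_source_mem_nhds (EuclideanSpace ℝ (Fin n)) q)
  filter_upwards [prod_mem_prod A' A'] with ⟨x, y⟩ ⟨⟨hx, h'x⟩, ⟨hy, h'y⟩⟩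
  rw [IsRiemannianManifold.out (I := 𝓡 n) x y]
  -- `γ` is the image under the inverse chart of the segment `η`
  let η := ContinuousAffineMap.lineMap (R := ℝ) (extChartAt (𝓡 n) q x) (extChartAt (𝓡 n) q y)
  set γ := (extChartAt (𝓡 n) q).symm ∘ η
  have hη : Icc 0 1 ⊆ ⇑η ⁻¹' ((extChartAt (𝓡 n) q).target ∩
        {y | ∀ ξ : EuclideanSpace ℝ (Fin n),
          ‖mfderivWithin 𝓘(ℝ, EuclideanSpace ℝ (Fin n)) (𝓡 n) (extChartAt (𝓡 n) q).symm
            (range (𝓡 n)) y ξ‖ ≤ C * ‖ξ‖}) := by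
    simp only [← image_subset_iff, ContinuousAffineMap.coe_lineMap_eq,
     ← segment_eq_image_lineMap, η]
    apply Subset.trans _ hr
    exact ((convex_ball _ _).inter (𝓡 n).convex_range).segment_subset hx hy
  simp only [preimage_inter, subset_inter_iff] at hη
  have η_smooth : ContMDiffOn 𝓘(ℝ, ℝ) 𝓘(ℝ, EuclideanSpace ℝ (Fin n)) 1 η (Icc 0 1) := by
    apply ContMDiff.contMDiffOn
    rw [contMDiff_iff_contDiff]
    exact ContinuousAffineMap.contDiff _
  have : Manifold.riemannianEDist (𝓡 n) x y ≤ Manifold.pathELength (𝓡 n) γ 0 1 := by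
    apply Manifold.riemannianEDist_le_pathELength _ _ _ zero_le_one
    · exact (contMDiffOn_extChartAt_symm q).comp η_smooth hη.1
    · simp [γ, η, ContinuousAffineMap.coe_lineMap_eq, h'x]
    · simp [γ, η, ContinuousAffineMap.coe_lineMap_eq, h'y]
  apply this.trans
  rw [← lintegral_fderiv_lineMap_eq_edist, Manifold.pathELength_eq_lintegral_mfderivWithin_Icc,
    ← lintegral_const_mul' _ _ ENNReal.coe_ne_top]
  apply setLIntegral_mono' measurableSet_Icc (fun t ht ↦ ?_)
  have : mfderivWithin 𝓘(ℝ, ℝ) (𝓡 n) γ (Icc 0 1) t =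
      (mfderivWithin 𝓘(ℝ, EuclideanSpace ℝ (Fin n)) (𝓡 n) (extChartAt (𝓡 n) q).symm
        (range (𝓡 n)) (η t)) ∘L
        (mfderivWithin 𝓘(ℝ, ℝ) 𝓘(ℝ, EuclideanSpace ℝ (Fin n)) η (Icc 0 1) t) := by
    apply mfderivWithin_comp
    · exact mdifferentiableWithinAt_extChartAt_symm (hη.1 ht)
    · exact η_smooth.mdifferentiableOn one_ne_zero t ht
    · exact hη.1.trans (preimage_mono (extChartAt_target_subset_range q))
    · rw [uniqueMDiffWithinAt_iff_uniqueDiffWithinAt]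
      exact uniqueDiffOn_Icc zero_lt_one t ht
  have : mfderivWithin 𝓘(ℝ, ℝ) (𝓡 n) γ (Icc 0 1) t 1 =
      (mfderivWithin 𝓘(ℝ, EuclideanSpace ℝ (Fin n)) (𝓡 n) (extChartAt (𝓡 n) q).symm
        (range (𝓡 n)) (η t))
        (mfderivWithin 𝓘(ℝ, ℝ) 𝓘(ℝ, EuclideanSpace ℝ (Fin n)) η (Icc 0 1) t 1) :=
    congr($this 1)
  rw [this]
  have hle := ENNReal.ofReal_le_ofReal (hη.2 ht (fderivWithin ℝ η (Icc 0 1) t 1))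
  rw [ENNReal.ofReal_mul (by positivity), ENNReal.ofReal_coe_nnreal, ofReal_norm,
    ofReal_norm] at hle
  simp only [mfderivWithin_eq_fderivWithin]
  exact hle

end

end Manifolds

/-! ### Lipschitz embeddings in Euclidean spaces -/

/-- A map on a finite-dimensional space is locally antilipschitz where its strict derivative is
injective. -/
theorem HasStrictFDerivAt.exists_norm_sub_le_of_injective {E F : Type*} [NormedAddCommGroup E]
    [NormedSpace ℝ E] [FiniteDimensional ℝ E] [NormedAddCommGroup F] [NormedSpace ℝ F]
    {f : E → F} {f' : E →L[ℝ] F} {a : E} (hf : HasStrictFDerivAt f f' a)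
    (hinj : Function.Injective f') :
    ∃ K : ℝ, 0 < K ∧ ∀ᶠ p : E × E in 𝓝 (a, a), ‖p.1 - p.2‖ ≤ K * ‖f p.1 - f p.2‖ := by
  obtain ⟨K, hK, hA⟩ := LinearMap.exists_antilipschitzWith (f' : E →ₗ[ℝ] F)
    (LinearMap.ker_eq_bot.2 hinj)
  have hK' : (0 : ℝ) < K := hK
  refine ⟨2 * K, by positivity, ?_⟩
  filter_upwards [hf.isLittleO.def (c := 1 / (2 * K)) (by positivity)] with p hp
  have h1 : ‖p.1 - p.2‖ ≤ K * ‖f' (p.1 - p.2)‖ := by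
    simpa [edist_dist, dist_eq_norm, map_sub] using hA.le_mul_dist p.1 p.2
  have h2 : ‖f' (p.1 - p.2)‖ ≤ ‖f p.1 - f p.2‖ + 1 / (2 * K) * ‖p.1 - p.2‖ := by
    have := norm_sub_norm_le (f' (p.1 - p.2)) (f p.1 - f p.2)
    rw [norm_sub_rev (f' (p.1 - p.2))] at this
    linarith
  have h3 : K * ‖f' (p.1 - p.2)‖ ≤ K * ‖f p.1 - f p.2‖ + 1 / 2 * ‖p.1 - p.2‖ := by
    calc K * ‖f' (p.1 - p.2)‖ ≤ K * (‖f p.1 - f p.2‖ + 1 / (2 * K) * ‖p.1 - p.2‖) := by gcongr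
      _ = _ := by field_simp
  linarith

section Manifolds

variable {n : ℕ} {M : Type*} [MetricSpace M]
  [ChartedSpace (EuclideanSpace ℝ (Fin n)) M] [IsManifold (𝓡 n) ∞ M]
  [RiemannianBundle (fun x : M => TangentSpace (𝓡 n) x)]
  [IsContMDiffRiemannianBundle (𝓡 n) ∞ (EuclideanSpace ℝ (Fin n))
    (fun x : M => TangentSpace (𝓡 n) x)]

theorem exists_eventually_dist_le_of_injective_mfderiv [IsRiemannianManifold (𝓡 n) M] {V : Type*}
    [NormedAddCommGroup V] [NormedSpace ℝ V] {e : M → V} (he : ContMDiff (𝓡 n) 𝓘(ℝ, V) ∞ e) (q : M)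
    (hinj : Function.Injective (mfderiv (𝓡 n) 𝓘(ℝ, V) e q)) :
    ∃ C : ℝ, 0 < C ∧ ∀ᶠ p : M × M in 𝓝 (q, q), dist p.1 p.2 ≤ C * ‖e p.1 - e p.2‖ := by
  have hq := mem_extChartAt_target (I := 𝓡 n) q
  have hopen : IsOpen (extChartAt (𝓡 n) q).target := isOpen_extChartAt_target q
  have hd : ContDiffAt ℝ ∞ (e ∘ (extChartAt (𝓡 n) q).symm) (extChartAt (𝓡 n) q q) := by
    have : ContDiffOn ℝ ∞ (e ∘ (extChartAt (𝓡 n) q).symm) (extChartAt (𝓡 n) q).target := by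
      rw [← contMDiffOn_iff_contDiffOn]
      exact he.comp_contMDiffOn (contMDiffOn_extChartAt_symm q)
    exact this.contDiffAt (hopen.mem_nhds hq)
  have hs := hd.hasStrictFDerivAt (by simp)
  have hinj' : Function.Injective
      (fderiv ℝ (e ∘ (extChartAt (𝓡 n) q).symm) (extChartAt (𝓡 n) q q)) := by
    have h := (he.mdifferentiable (by simp) q).mfderiv
    have h' (v : EuclideanSpace ℝ (Fin n)) : (mfderiv (𝓡 n) 𝓘(ℝ, V) e q v : V) =
        fderiv ℝ (e ∘ (extChartAt (𝓡 n) q).symm) (extChartAt (𝓡 n) q q) v := by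
      rw [h]
      simp only [writtenInExtChartAt, ModelWithCorners.range_eq_univ, fderivWithin_univ]
      rfl
    intro v w hvw
    exact hinj ((h' v).trans (hvw.trans (h' w).symm))
  obtain ⟨K, hK, hev⟩ := hs.exists_norm_sub_le_of_injective hinj'
  obtain ⟨C, hC⟩ := exists_edist_le_edist_extChartAt (n := n) q
  refine ⟨(C + 1) * K, by positivity, ?_⟩
  rw [nhds_prod_eq]
  have ht : Tendsto (fun p : M × M => (extChartAt (𝓡 n) q p.1, extChartAt (𝓡 n) q p.2))
      (𝓝 q ×ˢ 𝓝 q) (𝓝 (extChartAt (𝓡 n) q q, extChartAt (𝓡 n) q q)) := by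
    rw [nhds_prod_eq]
    exact (continuousAt_extChartAt q).tendsto.prodMap (continuousAt_extChartAt q).tendsto
  have hsrc := extChartAt_source_mem_nhds (I := 𝓡 n) q
  filter_upwards [hC, ht.eventually hev, prod_mem_prod hsrc hsrc] with p hp1 hp2 hp3
  have hp1' : dist p.1 p.2 ≤ C * dist (extChartAt (𝓡 n) q p.1) (extChartAt (𝓡 n) q p.2) := by
    rw [edist_dist, edist_dist, ← ENNReal.ofReal_coe_nnreal,
      ← ENNReal.ofReal_mul (by positivity)] at hp1
    exact (ENNReal.ofReal_le_ofReal_iff (by positivity)).1 hp1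
  simp only [Function.comp_apply, (extChartAt (𝓡 n) q).left_inv hp3.1,
    (extChartAt (𝓡 n) q).left_inv hp3.2] at hp2
  rw [dist_eq_norm] at hp1'
  calc dist p.1 p.2 ≤ C * ‖extChartAt (𝓡 n) q p.1 - extChartAt (𝓡 n) q p.2‖ := hp1'
    _ ≤ (C + 1) * (K * ‖e p.1 - e p.2‖) := by gcongr; simp
    _ = _ := by ring

/-- A compact Riemannian manifold has a smooth map to a Euclidean space with Lipschitz inverse. The
map is a Whitney embedding; near the diagonal of `M × M` the estimate comes from injectivity of the
derivative, away from it from injectivity and compactness. -/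
theorem exists_contMDiff_dist_le [CompactSpace M] [IsRiemannianManifold (𝓡 n) M] :
    ∃ (m : ℕ) (e : M → EuclideanSpace ℝ (Fin m)) (C : ℝ), ContMDiff (𝓡 n) (𝓡 m) ∞ e ∧ 0 < C ∧
      ∀ x y, dist x y ≤ C * ‖e x - e y‖ := by
  obtain ⟨m, e, he, hemb, hinj⟩ := exists_embedding_euclidean_of_compact (I := 𝓡 n) (M := M)
  suffices H : ∃ C : ℝ, 0 < C ∧ ∀ p ∈ (univ : Set (M × M)), dist p.1 p.2 ≤ C * ‖e p.1 - e p.2‖ by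
    obtain ⟨C, hC, h⟩ := H
    exact ⟨m, e, C, he, hC, fun x y => h (x, y) trivial⟩
  refine isCompact_univ.induction_on
    (p := fun s => ∃ C : ℝ, 0 < C ∧ ∀ p : M × M, p ∈ s → dist p.1 p.2 ≤ C * ‖e p.1 - e p.2‖)
    ⟨1, one_pos, by simp⟩ ?_ ?_ ?_
  · rintro s t hst ⟨B, hB, h⟩
    exact ⟨B, hB, fun x hx => h x (hst hx)⟩
  · rintro s t ⟨B, hB, h⟩ ⟨B', hB', h'⟩
    refine ⟨max B B', by positivity, ?_⟩
    rintro x (hx | hx)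
    · exact (h x hx).trans (by gcongr; exact le_max_left _ _)
    · exact (h' x hx).trans (by gcongr; exact le_max_right _ _)
  · rintro ⟨x, y⟩ -
    rcases eq_or_ne x y with rfl | hxy
    · obtain ⟨C, hC, h⟩ := exists_eventually_dist_le_of_injective_mfderiv he x (hinj x)
      exact ⟨_, mem_nhdsWithin_of_mem_nhds h, C, hC, fun p hp => hp⟩
    · have hpos : 0 < ‖e x - e y‖ := norm_pos_iff.2 (sub_ne_zero.2 (hemb.injective.ne hxy))
      have hc1 : Continuous fun p : M × M => ‖e p.1 - e p.2‖ :=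
        ((he.continuous.comp continuous_fst).sub (he.continuous.comp continuous_snd)).norm
      refine ⟨_, mem_nhdsWithin_of_mem_nhds (hc1.continuousAt.eventually
        (lt_mem_nhds (half_lt_self hpos))), (Metric.diam (univ : Set M) + 1) / (‖e x - e y‖ / 2),
        div_pos (add_pos_of_nonneg_of_pos Metric.diam_nonneg one_pos) (by positivity), ?_⟩
      rintro p hp
      have h1 : dist p.1 p.2 ≤ Metric.diam (univ : Set M) :=
        Metric.dist_le_diam_of_mem isCompact_univ.isBounded trivial trivial
      have h2 : ‖e x - e y‖ / 2 ≤ ‖e p.1 - e p.2‖ := le_of_lt hp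
      have h0 : 0 ≤ Metric.diam (univ : Set M) := Metric.diam_nonneg
      rw [div_mul_eq_mul_div, le_div_iff₀ (by positivity)]
      exact mul_le_mul (by linarith) h2 (by positivity) (by linarith)

end Manifolds

/-! ### A continuously differentiable substitute for the distance to a point -/

/-- A bounded distance from `z` to `p`, smoothed at scale `η`. With `t = √(‖z - p‖² + η²) - η`,
which is differentiable at `z = p`, it equals `t / (1 + t)`; it takes values in `[0, 1]`, is
`1`-Lipschitz, vanishes only at `p`, and is comparable to `‖z - p‖` on bounded sets as soon as
`η ≤ ‖z - p‖`. -/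
noncomputable def softDist {V : Type*} [NormedAddCommGroup V] (η : ℝ) (p z : V) : ℝ :=
  1 - (1 + (√(‖z - p‖ ^ 2 + η ^ 2) - η))⁻¹

section softDist

variable {V : Type*} [NormedAddCommGroup V] {η : ℝ} (p : V)

theorem le_sqrt_sq_add_sq (a η : ℝ) : η ≤ √(a ^ 2 + η ^ 2) :=
  Real.le_sqrt_of_sq_le (by nlinarith [sq_nonneg a])

theorem softDist_nonneg (η : ℝ) (z : V) : 0 ≤ softDist η p z := by
  have := le_sqrt_sq_add_sq ‖z - p‖ η
  rw [softDist, sub_nonneg]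
  exact inv_le_one_of_one_le₀ (by linarith)

theorem softDist_le_one (η : ℝ) (z : V) : softDist η p z ≤ 1 := by
  have := le_sqrt_sq_add_sq ‖z - p‖ η
  rw [softDist, sub_le_self_iff]
  exact inv_nonneg.2 (by linarith)

theorem softDist_eq_zero_iff (hη : 0 < η) {z : V} : softDist η p z = 0 ↔ z = p := by
  rw [softDist, sub_eq_zero, eq_comm, inv_eq_one, add_eq_left, sub_eq_zero,
    Real.sqrt_eq_iff_mul_self_eq_of_pos hη, ← sub_eq_zero (a := z)]
  constructor
  · intro h
    have : ‖z - p‖ ^ 2 = 0 := by linarith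
    simpa using this
  · intro h; simp [h]; ring

theorem lipschitzWith_softDist (η : ℝ) : LipschitzWith 1 (softDist η p) := by
  refine LipschitzWith.of_le_add fun x y => ?_
  set a := ‖x - p‖
  set b := ‖y - p‖
  have hab : a ≤ b + dist x y := by
    rw [dist_eq_norm, add_comm]
    simpa [a, b] using norm_add_le (x - y) (y - p)
  have h0 := le_sqrt_sq_add_sq b η
  have h0' := le_sqrt_sq_add_sq a η
  have hd := dist_nonneg (x := x) (y := y)
  have ha : 0 ≤ a := norm_nonneg _
  have hb : 0 ≤ b := norm_nonneg _
  have hbs : b ≤ √(b ^ 2 + η ^ 2) := Real.le_sqrt_of_sq_le (by nlinarith [sq_nonneg η])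
  have h1 : √(a ^ 2 + η ^ 2) ≤ √(b ^ 2 + η ^ 2) + dist x y := by
    refine Real.sqrt_le_iff.2 ⟨by positivity, ?_⟩
    have := Real.sq_sqrt (show 0 ≤ b ^ 2 + η ^ 2 by positivity)
    nlinarith
  simp only [softDist]
  change 1 - (1 + (√(a ^ 2 + η ^ 2) - η))⁻¹ ≤ 1 - (1 + (√(b ^ 2 + η ^ 2) - η))⁻¹ + dist x y
  set s := √(a ^ 2 + η ^ 2) - η
  set t := √(b ^ 2 + η ^ 2) - η
  have hs : 0 ≤ s := by simp only [s]; linarith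
  have ht : 0 ≤ t := by simp only [t]; linarith
  have hst : s ≤ t + dist x y := by simp only [s, t]; linarith
  suffices (1 + t)⁻¹ - (1 + s)⁻¹ ≤ dist x y by linarith
  rw [inv_sub_inv (by positivity) (by positivity), div_le_iff₀ (by positivity)]
  nlinarith [mul_nonneg ht hs, mul_nonneg hd ht, mul_nonneg hd hs, mul_nonneg hd (mul_nonneg ht hs)]

theorem le_softDist {D r : ℝ} (hη : 0 < η) {z : V} (hr : η ≤ r) (hrz : r ≤ ‖z - p‖) (hD : r ≤ D) :
    r / (3 + D) ≤ softDist η p z := by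
  have h1 : r / 3 ≤ √(‖z - p‖ ^ 2 + η ^ 2) - η := by
    -- `(r / 3 + η)² ≤ r² + η²` because `η ≤ r`
    rw [le_sub_iff_add_le]
    refine Real.le_sqrt_of_sq_le ?_
    nlinarith
  rw [softDist]
  set t := √(‖z - p‖ ^ 2 + η ^ 2) - η
  have ht : 0 < t := by linarith
  have : 1 - (1 + t)⁻¹ = t / (1 + t) := by field_simp; ring
  rw [this, div_le_div_iff₀ (by linarith) (by linarith)]
  nlinarith

theorem contDiff_softDist {V : Type*} [NormedAddCommGroup V] [InnerProductSpace ℝ V]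
    (hη : 0 < η) (p : V) : ContDiff ℝ 1 (softDist η p) := by
  refine contDiff_const.sub (ContDiff.inv (contDiff_const.add
    ((ContDiff.sqrt (((contDiff_id.sub contDiff_const).norm_sq ℝ).add contDiff_const)
      fun z => by positivity).sub contDiff_const)) fun z => ?_)
  have := le_sqrt_sq_add_sq ‖z - p‖ η
  have h : (0 : ℝ) < 1 + (√(‖z - p‖ ^ 2 + η ^ 2) - η) := by linarith
  exact h.ne'

end softDist

theorem LipschitzWith.finset_prod_of_mem_Icc {α ι : Type*} [PseudoMetricSpace α] {f : ι → α → ℝ}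
    (s : Finset ι) (hf : ∀ i, LipschitzWith 1 (f i)) (h0 : ∀ i x, 0 ≤ f i x)
    (h1 : ∀ i x, f i x ≤ 1) : LipschitzWith s.card fun x => ∏ i ∈ s, f i x := by
  classical
  refine LipschitzWith.of_dist_le_mul fun x y => ?_
  induction s using Finset.induction_on with
  | empty => simp
  | insert i s hi ih =>
    rw [Finset.prod_insert hi, Finset.prod_insert hi, Finset.card_insert_of_notMem hi]
    have hp0 : 0 ≤ ∏ i ∈ s, f i x := Finset.prod_nonneg fun j _ => h0 j x
    have hp1 : ∏ i ∈ s, f i x ≤ 1 := Finset.prod_le_one (fun j _ => h0 j x) fun j _ => h1 j x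
    have hi' : |f i x - f i y| ≤ dist x y := by
      simpa [Real.dist_eq] using (hf i).dist_le_mul x y
    rw [Real.dist_eq] at ih ⊢
    set a := ∏ i ∈ s, f i x
    set b := ∏ i ∈ s, f i y
    calc |f i x * a - f i y * b| = |(f i x - f i y) * a + f i y * (a - b)| := by ring_nf
      _ ≤ |f i x - f i y| * |a| + |f i y| * |a - b| := by
        rw [← abs_mul, ← abs_mul]; exact abs_add_le _ _
      _ ≤ dist x y * 1 + 1 * ((s.card : ℝ≥0) * dist x y) := by
        gcongr
        · rwa [abs_of_nonneg hp0]
        · rw [abs_of_nonneg (h0 _ _)]; exact h1 _ _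
      _ = _ := by push_cast; ring

/-! ### The supremum norm of the derivative and smoothed distances to finite sets -/

section Manifolds

variable {n : ℕ} {M : Type*} [MetricSpace M]
  [ChartedSpace (EuclideanSpace ℝ (Fin n)) M]
  [RiemannianBundle (fun x : M => TangentSpace (𝓡 n) x)]

/-- The operator norm refers to Mathlib's Riemannian norm on the tangent space of `ℝ`, the
hypothesis to the usual norm of `ℝ`. -/
theorem norm_mfderiv_le_of_apply_le {F : M → ℝ} {B : ℝ} (hB : 0 ≤ B) {x : M}
    (h : ∀ ξ : TangentSpace (𝓡 n) x, @norm ℝ _ (mfderiv (𝓡 n) 𝓘(ℝ, ℝ) F x ξ) ≤ B * ‖ξ‖) :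
    ‖mfderiv (𝓡 n) 𝓘(ℝ, ℝ) F x‖ ≤ B := by
  refine ContinuousLinearMap.opNorm_le_bound _ hB fun ξ => ?_
  rw [norm_tangentSpace_vectorSpace]
  exact h ξ

theorem supNormDeriv_nonneg (F : M → ℝ) : 0 ≤ supNormDeriv (n := n) F :=
  Real.iSup_nonneg fun _ => ContinuousLinearMap.opNorm_nonneg _

theorem norm_mfderiv_const_mul_le {F : M → ℝ} (hF : ContMDiff (𝓡 n) 𝓘(ℝ, ℝ) 1 F) (c : ℝ) (x : M) :
    ‖mfderiv (𝓡 n) 𝓘(ℝ, ℝ) (fun x => c * F x) x‖ ≤ |c| * ‖mfderiv (𝓡 n) 𝓘(ℝ, ℝ) F x‖ := by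
  refine norm_mfderiv_le_of_apply_le
    (mul_nonneg (abs_nonneg c) (ContinuousLinearMap.opNorm_nonneg _)) fun ξ => ?_
  have h : mfderiv (𝓡 n) 𝓘(ℝ, ℝ) (fun x => c * F x) x ξ =
      @HMul.hMul ℝ ℝ ℝ _ c (mfderiv (𝓡 n) 𝓘(ℝ, ℝ) F x ξ) :=
    congr($(const_smul_mfderiv (hF.mdifferentiable one_ne_zero x) c) ξ)
  have h' := (mfderiv (𝓡 n) 𝓘(ℝ, ℝ) F x).le_opNorm ξ
  rw [norm_tangentSpace_vectorSpace] at h'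
  rw [h, mul_assoc]
  exact (norm_mul_le _ _).trans (mul_le_mul_of_nonneg_left h' (abs_nonneg c))

variable [IsManifold (𝓡 n) ∞ M]
  [IsContMDiffRiemannianBundle (𝓡 n) ∞ (EuclideanSpace ℝ (Fin n))
    (fun x : M => TangentSpace (𝓡 n) x)]

theorem bddAbove_range_norm_mfderiv [CompactSpace M] {F : M → ℝ}
    (hF : ContMDiff (𝓡 n) 𝓘(ℝ, ℝ) 1 F) :
    BddAbove (range fun x : M => ‖mfderiv (𝓡 n) 𝓘(ℝ, ℝ) F x‖) := by
  obtain ⟨B, hB, h⟩ := exists_norm_mfderiv_apply_le hF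
  exact ⟨B, by rintro _ ⟨x, rfl⟩; exact norm_mfderiv_le_of_apply_le hB.le (h x)⟩

theorem abs_sub_le_supNormDeriv_mul_dist [CompactSpace M] [IsRiemannianManifold (𝓡 n) M] {F : M → ℝ}
    (hF : ContMDiff (𝓡 n) 𝓘(ℝ, ℝ) 1 F) (x y : M) :
    |F x - F y| ≤ supNormDeriv (n := n) F * dist x y := by
  rw [dist_comm]
  refine norm_sub_le_of_norm_mfderiv_apply_le (supNormDeriv_nonneg F) hF (fun z ξ => ?_) y x
  have h := (mfderiv (𝓡 n) 𝓘(ℝ, ℝ) F z).le_opNorm ξ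
  rw [norm_tangentSpace_vectorSpace] at h
  exact h.trans (mul_le_mul_of_nonneg_right (le_ciSup (bddAbove_range_norm_mfderiv hF) z)
    (norm_nonneg _))

/-- A `C¹` function which behaves like the distance to a finite set `S`: it is nonnegative, vanishes
exactly on `S`, and dominates a multiple of the distance to `S` beyond the scale `η`. The bounds `B`
and `κ` do not depend on `η`, and depend on `S` only through its cardinality and separation. The
function is a product of softened distances to the points of `S` in a Euclidean embedding; at each
point at most one factor is small. -/
theorem exists_contMDiff_softDist [CompactSpace M] [IsRiemannianManifold (𝓡 n) M] (P : ℕ) {γ : ℝ}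
    (hγ : 0 < γ) :
    ∃ B κ : ℝ, 0 < B ∧ 0 < κ ∧ ∀ S : Finset M, S.Nonempty → S.card ≤ P →
      (∀ p ∈ S, ∀ q ∈ S, p ≠ q → γ ≤ dist p q) → ∀ η : ℝ, 0 < η →
      ∃ w : M → ℝ, ContMDiff (𝓡 n) 𝓘(ℝ, ℝ) 1 w ∧ (∀ y, 0 ≤ w y) ∧ (∀ y, w y = 0 ↔ y ∈ S) ∧
        (∀ y, ‖mfderiv (𝓡 n) 𝓘(ℝ, ℝ) w y‖ ≤ B) ∧
        ∀ (y : M) (r : ℝ), η ≤ r → (∀ p ∈ S, r ≤ dist y p) → κ * r ≤ w y := by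
  classical
  obtain ⟨m, e, C, he, hC, hdist⟩ := exists_contMDiff_dist_le (n := n) (M := M)
  obtain ⟨B, hB, hder⟩ := exists_norm_mfderiv_apply_le (he.of_le (m := 1) (by simp))
  set D := Metric.diam (univ : Set M) with hD
  have hD0 : 0 ≤ D := Metric.diam_nonneg
  have hdD (x y : M) : dist x y ≤ D :=
    Metric.dist_le_diam_of_mem isCompact_univ.isBounded trivial trivial
  have heinj : Function.Injective e := fun x y hxy => by
    have := hdist x y
    rw [hxy, sub_self, norm_zero, mul_zero] at this
    exact dist_le_zero.1 this
  set κ := 1 / (3 * C + D) with hκ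
  have hκ0 : 0 < κ := by positivity
  set μ := min 1 (κ * (γ / 2)) with hμ
  have hμ0 : 0 < μ := lt_min one_pos (by positivity)
  refine ⟨(P + 1) * B, κ * μ ^ P, by positivity, by positivity, ?_⟩
  intro S hS hcard hsep η hη
  have hη' : 0 < η / C := by positivity
  let G : EuclideanSpace ℝ (Fin m) → ℝ := fun z => ∏ p ∈ S, softDist (η / C) (e p) z
  have hG : ContDiff ℝ 1 G := contDiff_prod fun p _ => contDiff_softDist hη' (e p)
  have hGlip : LipschitzWith S.card G := LipschitzWith.finset_prod_of_mem_Icc S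
    (fun p => lipschitzWith_softDist (e p) (η / C)) (fun p => softDist_nonneg (e p) _)
    (fun p => softDist_le_one (e p) _)
  have hlow (y p : M) (h : η ≤ dist y p) : κ * dist y p ≤ softDist (η / C) (e p) (e y) := by
    have := le_softDist (e p) (D := D / C) (r := dist y p / C) hη' (z := e y)
      (by gcongr) (by rw [div_le_iff₀ hC, mul_comm]; exact hdist y p)
      (by gcongr; exact hdD _ _)
    convert this using 1
    rw [hκ]; field_simp
  refine ⟨G ∘ e, hG.contMDiff.comp (he.of_le (by simp)),
    fun y => Finset.prod_nonneg fun p _ => softDist_nonneg _ _ _, fun y => ?_, fun y => ?_, ?_⟩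
  · simp only [G, Function.comp_apply, Finset.prod_eq_zero_iff, softDist_eq_zero_iff _ hη',
      heinj.eq_iff, exists_eq_right']
  · refine norm_mfderiv_le_of_apply_le (by positivity) fun ξ => ?_
    have hcomp : mfderiv (𝓡 n) 𝓘(ℝ, ℝ) (G ∘ e) y =
        (mfderiv (𝓡 m) 𝓘(ℝ, ℝ) G (e y)) ∘L (mfderiv (𝓡 n) (𝓡 m) e y) :=
      mfderiv_comp y (hG.contMDiff.mdifferentiable one_ne_zero _)
        (he.mdifferentiable (by simp) _)
    have happ : (mfderiv (𝓡 n) 𝓘(ℝ, ℝ) (G ∘ e) y ξ : ℝ) =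
        fderiv ℝ G (e y) (mfderiv (𝓡 n) (𝓡 m) e y ξ) := by
      rw [hcomp, mfderiv_eq_fderiv]; rfl
    rw [happ]
    refine (ContinuousLinearMap.le_opNorm _ _).trans ?_
    rw [mul_assoc]
    have h1 : ‖fderiv ℝ G (e y)‖ ≤ (P : ℝ) + 1 := by
      refine (norm_fderiv_le_of_lipschitz ℝ hGlip).trans ?_
      have : (S.card : ℝ) ≤ P := by exact_mod_cast hcard
      simp only [NNReal.coe_natCast]; linarith
    exact mul_le_mul h1 (hder y ξ) (norm_nonneg _) (by positivity)
  · intro y r hr hrS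
    obtain ⟨p₀, hp₀, hmin⟩ := S.exists_min_image (fun p => dist y p) hS
    have hr0 : 0 < r := hη.trans_le hr
    change κ * μ ^ P * r ≤ ∏ p ∈ S, softDist (η / C) (e p) (e y)
    rw [← Finset.mul_prod_erase S _ hp₀]
    have h1 : κ * r ≤ softDist (η / C) (e p₀) (e y) :=
      le_trans (by gcongr; exact hrS _ hp₀) (hlow y p₀ (hr.trans (hrS _ hp₀)))
    -- the other points of `S` are at distance at least `γ / 2` from `y`
    have h2 : μ ^ P ≤ ∏ p ∈ S.erase p₀, softDist (η / C) (e p) (e y) := by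
      calc μ ^ P ≤ μ ^ (S.erase p₀).card :=
            pow_le_pow_of_le_one hμ0.le (min_le_left _ _)
              ((Finset.card_le_card (Finset.erase_subset _ _)).trans hcard)
        _ = ∏ _p ∈ S.erase p₀, μ := by rw [Finset.prod_const]
        _ ≤ _ := by
          refine Finset.prod_le_prod (fun _ _ => hμ0.le) fun p hp => ?_
          obtain ⟨hne, hpS⟩ := Finset.mem_erase.1 hp
          refine le_trans ?_ (hlow y p (hr.trans (hrS _ hpS)))
          refine (min_le_right _ _).trans ?_
          gcongr
          have := hsep p hpS p₀ hp₀ hne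
          have := dist_triangle_left p p₀ y
          have := hmin p hpS
          linarith
    calc κ * μ ^ P * r = (κ * r) * μ ^ P := by ring
      _ ≤ _ := by
        refine mul_le_mul h1 h2 (by positivity) (softDist_nonneg _ _ _)

end Manifolds

/-! ### Orbit measures and maximizing measures -/

section OrbitMeasure

variable {X : Type*} {f : X → X} {x : X} {p : ℕ}

theorem range_iterate_eq_image_range (hp : 0 < p) (hx : f^[p] x = x) :
    (range fun k : ℕ => f^[k] x) = (fun k : ℕ => f^[k] x) '' (Finset.range p : Set ℕ) := by
  refine subset_antisymm ?_ (image_subset_range _ _)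
  rintro _ ⟨k, rfl⟩
  refine ⟨k % p, by simpa using Nat.mod_lt k hp, ?_⟩
  exact Function.IsPeriodicPt.iterate_mod_apply (f := f) (x := x) hx k

theorem IsPeriodicOrbit.exists_injOn {O : Set X} (hO : IsPeriodicOrbit f O) :
    ∃ x p, 0 < p ∧ f^[p] x = x ∧ InjOn (fun k => f^[k] x) (Finset.range p : Set ℕ) ∧
      O = range fun k : ℕ => f^[k] x := by
  obtain ⟨x, ⟨p, hp, hx⟩, rfl⟩ := hO
  refine ⟨x, Function.minimalPeriod f x, ?_, Function.iterate_minimalPeriod, ?_, rfl⟩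
  · exact Function.IsPeriodicPt.minimalPeriod_pos hp hx
  · intro k hk l hl h
    exact Function.iterate_injOn_Iio_minimalPeriod (by simpa using hk) (by simpa using hl) h

variable [MeasurableSpace X]

theorem orbitMeasure_range_iterate (hp : 0 < p) (hx : f^[p] x = x)
    (hinj : InjOn (fun k => f^[k] x) (Finset.range p : Set ℕ)) :
    orbitMeasure (range fun k : ℕ => f^[k] x) =
      (p : ℝ≥0∞)⁻¹ • ∑ k ∈ Finset.range p, Measure.dirac (f^[k] x) := by
  rw [orbitMeasure, range_iterate_eq_image_range hp hx, hinj.ncard_image, Set.ncard_coe_finset,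
    Finset.card_range, finsum_mem_image hinj, finsum_mem_coe_finset]

theorem integral_orbitMeasure [MeasurableSingletonClass X] (hp : 0 < p) (hx : f^[p] x = x)
    (hinj : InjOn (fun k => f^[k] x) (Finset.range p : Set ℕ)) (φ : X → ℝ) :
    ∫ y, φ y ∂orbitMeasure (range fun k : ℕ => f^[k] x) =
      (p : ℝ)⁻¹ * ∑ k ∈ Finset.range p, φ (f^[k] x) := by
  rw [orbitMeasure_range_iterate hp hx hinj, integral_smul_measure, integral_finsetSum_measure]
  · simp
  · intro k _
    exact integrable_dirac (by simp)

theorem orbitMeasure_mem_invariantMeasures (hf : Measurable f) (hp : 0 < p) (hx : f^[p] x = x)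
    (hinj : InjOn (fun k => f^[k] x) (Finset.range p : Set ℕ)) :
    orbitMeasure (range fun k : ℕ => f^[k] x) ∈ invariantMeasures f := by
  have hp' : (p : ℝ≥0∞) ≠ 0 := by simpa using hp.ne'
  rw [orbitMeasure_range_iterate hp hx hinj]
  refine ⟨⟨?_⟩, hf, ?_⟩
  · simp [ENNReal.inv_mul_cancel hp' (ENNReal.natCast_ne_top p)]
  · rw [Measure.map_smul, Measure.map_finset_sum hf.aemeasurable]
    congr 1
    simp_rw [Measure.map_dirac' hf, ← Function.iterate_succ_apply' f]
    -- both sums complete to the sum over `range (p + 1)`, as `f^[p] x = x`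
    have h1 := Finset.sum_range_succ (fun k => Measure.dirac (f^[k] x)) p
    rw [Finset.sum_range_succ', hx] at h1
    ext s hs
    have h2 := congr($h1 s)
    simp only [Measure.add_apply, Function.iterate_zero, id] at h2
    exact (ENNReal.add_left_inj (measure_ne_top _ _)).1 h2

/-- The only invariant probability measure carried by a periodic orbit is the orbit measure. -/
theorem eq_orbitMeasure_of_measure_compl_eq_zero [MeasurableSingletonClass X] (hp : 0 < p)
    (hx : f^[p] x = x) (hinj : InjOn (fun k => f^[k] x) (Finset.range p : Set ℕ)) {μ : Measure X}
    (hμ : μ ∈ invariantMeasures f) (h0 : μ (range fun k : ℕ => f^[k] x)ᶜ = 0) :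
    μ = orbitMeasure (range fun k : ℕ => f^[k] x) := by
  classical
  have := hμ.1
  -- `{z} ⊆ f⁻¹ {f z}` makes the mass nondecreasing along the orbit, hence constant by periodicity
  have hmono : Monotone fun k => μ {f^[k] x} := by
    refine monotone_nat_of_le_succ fun k => ?_
    rw [← hμ.2.measure_preimage (measurableSet_singleton (f^[k + 1] x)).nullMeasurableSet]
    exact measure_mono (by simp [Function.iterate_succ_apply'])
  have hconst (k : ℕ) (hk : k ∈ Finset.range p) : μ {f^[k] x} = μ {x} := by
    refine le_antisymm ?_ (hmono (Nat.zero_le k))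
    have := hmono (Finset.mem_range.1 hk).le
    simpa only [hx] using this
  have hdecomp (A : Set X) : μ A = ∑ k ∈ Finset.range p, μ {x} * A.indicator 1 (f^[k] x) := by
    have h1 : μ A = μ (A ∩ range fun k : ℕ => f^[k] x) :=
      (measure_inter_conull h0).symm
    have h2 : (A ∩ range fun k : ℕ => f^[k] x) =
        ⋃ k ∈ (Finset.range p).filter (fun k => f^[k] x ∈ A), {f^[k] x} := by
      rw [range_iterate_eq_image_range hp hx]
      ext y
      simp only [mem_inter_iff, mem_image, Finset.coe_range, mem_Iio, Finset.mem_filter,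
        Finset.mem_range, mem_iUnion, mem_singleton_iff, exists_prop]
      constructor
      · rintro ⟨hy, k, hk, rfl⟩; exact ⟨k, ⟨hk, hy⟩, rfl⟩
      · rintro ⟨k, ⟨hk, hy⟩, rfl⟩; exact ⟨hy, k, hk, rfl⟩
    rw [h1, h2, measure_biUnion_finset, Finset.sum_filter]
    · refine Finset.sum_congr rfl fun k hk => ?_
      by_cases h : f^[k] x ∈ A <;> simp [h, hconst k hk]
    · intro k hk l hl hkl
      have hk' := (Finset.mem_filter.1 hk).1
      have hl' := (Finset.mem_filter.1 hl).1
      simpa [Function.onFun] using hinj.ne hk' hl' hkl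
    · intro k _; exact measurableSet_singleton _
  have hc : μ {x} = (p : ℝ≥0∞)⁻¹ := by
    have := hdecomp univ
    rw [measure_univ] at this
    simp only [indicator_univ, Pi.one_apply, mul_one, Finset.sum_const, Finset.card_range,
      nsmul_eq_mul] at this
    exact ENNReal.eq_inv_of_mul_eq_one_left (by rw [mul_comm]; exact this.symm)
  rw [orbitMeasure_range_iterate hp hx hinj]
  ext A hA
  rw [hdecomp A, hc, Measure.smul_apply, Measure.finsetSum_apply, smul_eq_mul, Finset.mul_sum]
  simp [Measure.dirac_apply' _ hA]

end OrbitMeasure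

section Maximizing

variable {X : Type*} [MeasurableSpace X] {g : X → X} {Φ : X → ℝ} {μ₀ : Measure X}

theorem maxErgodicAverage_eq (h0 : μ₀ ∈ invariantMeasures g)
    (h : ∀ μ ∈ invariantMeasures g, ∫ y, Φ y ∂μ ≤ ∫ y, Φ y ∂μ₀) :
    maxErgodicAverage g Φ = ∫ y, Φ y ∂μ₀ := by
  refine IsGreatest.csSup_eq ⟨⟨μ₀, h0, rfl⟩, ?_⟩
  rintro _ ⟨μ, hμ, rfl⟩
  exact h μ hμ

theorem mem_maximizingMeasures (h0 : μ₀ ∈ invariantMeasures g)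
    (h : ∀ μ ∈ invariantMeasures g, ∫ y, Φ y ∂μ ≤ ∫ y, Φ y ∂μ₀) :
    μ₀ ∈ maximizingMeasures g Φ := ⟨h0, (maxErgodicAverage_eq h0 h).symm⟩

theorem maximizingMeasures_eq_singleton (h0 : μ₀ ∈ invariantMeasures g)
    (h : ∀ μ ∈ invariantMeasures g, ∫ y, Φ y ∂μ ≤ ∫ y, Φ y ∂μ₀)
    (heq : ∀ μ ∈ invariantMeasures g, ∫ y, Φ y ∂μ = ∫ y, Φ y ∂μ₀ → μ = μ₀) :
    maximizingMeasures g Φ = {μ₀} := by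
  refine subset_antisymm (fun μ hμ => heq μ hμ.1 ?_)
    (singleton_subset_iff.2 (mem_maximizingMeasures h0 h))
  rw [hμ.2, maxErgodicAverage_eq h0 h]

/-- A function whose Birkhoff sums are bounded above on a set of full measure has nonpositive
integral. -/
theorem integral_nonpos_of_sum_le {T : Set X} {C : ℝ} (h : ∀ y ∈ T, ∀ n : ℕ,
    ∑ k ∈ Finset.range n, Φ (g^[k] y) ≤ C) {μ : Measure X} (hμ : μ ∈ invariantMeasures g)
    (hT : ∀ᵐ y ∂μ, y ∈ T) (hΦ : Integrable Φ μ) : ∫ y, Φ y ∂μ ≤ 0 := by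
  have := hμ.1
  have hk (k : ℕ) : Integrable (fun y => Φ (g^[k] y)) μ :=
    (hμ.2.iterate k).integrable_comp_of_integrable hΦ
  have hk' (k : ℕ) : ∫ y, Φ (g^[k] y) ∂μ = ∫ y, Φ y ∂μ := by
    have := integral_map (hμ.2.iterate k).measurable.aemeasurable
      (f := Φ) (by rw [(hμ.2.iterate k).map_eq]; exact hΦ.aestronglyMeasurable)
    rw [← this, (hμ.2.iterate k).map_eq]
  have hle (n : ℕ) : n * ∫ y, Φ y ∂μ ≤ C := by
    calc n * ∫ y, Φ y ∂μ = ∫ y, ∑ k ∈ Finset.range n, Φ (g^[k] y) ∂μ := by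
          rw [integral_finsetSum _ fun k _ => hk k]; simp [hk']
      _ ≤ ∫ _, C ∂μ := integral_mono_ae (integrable_finsetSum _ fun k _ => hk k)
          (integrable_const C) (hT.mono fun y hy => h y hy n)
      _ = C := by simp
  by_contra! hpos
  obtain ⟨n, hn⟩ := exists_nat_gt (C / ∫ y, Φ y ∂μ)
  rw [div_lt_iff₀ hpos] at hn
  exact absurd (hle n) (not_le.2 hn)

/-- Invariant probability measures are carried by the nonwandering set, by Poincaré recurrence. -/
theorem ae_mem_nonwanderingSet [TopologicalSpace X] [SecondCountableTopology X]
    [OpensMeasurableSpace X] {μ : Measure X} (hμ : μ ∈ invariantMeasures g) :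
    ∀ᵐ y ∂μ, y ∈ nonwanderingSet g := by
  have := hμ.1
  filter_upwards [hμ.2.conservative.ae_frequently_mem_of_mem_nhds] with y hy V hV hyV
  obtain ⟨n, hn, hn'⟩ := (hy V (hV.mem_nhds hyV)).forall_exists_of_atTop 1
  exact ⟨n, hn, y, hyV, hn'⟩

end Maximizing

theorem mem_nonwanderingSet_of_iterate_eq {X : Type*} [TopologicalSpace X] {f : X → X} {x : X}
    {p : ℕ} (hp : 0 < p) (hx : f^[p] x = x) : x ∈ nonwanderingSet f :=
  fun V _ hxV => ⟨p, hp, x, hxV, by rwa [mem_preimage, hx]⟩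

/-! ### Birkhoff sums and shadowing of a periodic orbit -/

theorem sum_iterate_add {X : Type*} (g : X → X) (s : X → ℝ) (y : X) (a b : ℕ) :
    ∑ k ∈ Finset.range (a + b), s (g^[k] y) =
      ∑ k ∈ Finset.range a, s (g^[k] y) + ∑ k ∈ Finset.range b, s (g^[k] (g^[a] y)) := by
  rw [Finset.sum_range_add]
  congr 1
  refine Finset.sum_congr rfl fun k _ => ?_
  rw [add_comm a k, Function.iterate_add_apply]

/-- A bound for Birkhoff sums of `s`. The function is nonpositive where `near` fails; a stretch of
orbit which starts and ends in `near` without meeting `far` costs at most `B`; and each visit to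
`far` pays `B` back. Hence only the last stretch can contribute. -/
theorem sum_le_of_excursions {X : Type*} {g : X → X} {T : Set X} (hT : MapsTo g T T)
    {near far : X → Prop} {s : X → ℝ} {B : ℝ} (hB : 0 ≤ B)
    (h_away : ∀ y ∈ T, ¬ near y → s y ≤ 0) (h_far : ∀ y ∈ T, far y → s y ≤ -B)
    (h_block : ∀ y ∈ T, ∀ b, near y → near (g^[b] y) → (∀ k ≤ b, ¬ far (g^[k] y)) →
      ∑ k ∈ Finset.range (b + 1), s (g^[k] y) ≤ B) :
    ∀ n, ∀ y ∈ T, ∑ k ∈ Finset.range n, s (g^[k] y) ≤ B := by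
  -- orbits which avoid `far`: discard the steps before the first and after the last visit to `near`
  have hsub : ∀ n, ∀ y ∈ T, (∀ k < n, ¬ far (g^[k] y)) →
      ∑ k ∈ Finset.range n, s (g^[k] y) ≤ B := by
    intro n
    induction n with
    | zero => intro y _ _; simpa using hB
    | succ n ih =>
      intro y hy hfar
      by_cases hn : near (g^[n] y)
      · by_cases h0 : near y
        · exact h_block y hy n h0 hn fun k hk => hfar k (Nat.lt_succ_of_le hk)
        · rw [add_comm, sum_iterate_add]
          have h1 := h_away y hy h0
          have h2 := ih (g y) (hT hy) fun k hk => by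
            rw [← Function.iterate_succ_apply]; exact hfar (k + 1) (by omega)
          simp only [Finset.sum_range_one, Function.iterate_zero, id, Function.iterate_one]
          linarith
      · rw [Finset.sum_range_succ]
        have h1 := h_away _ (hT.iterate n hy) hn
        have h2 := ih y hy fun k hk => hfar k (by omega)
        linarith
  intro n
  induction n using Nat.strong_induction_on with
  | _ n ih =>
    intro y hy
    classical
    -- cut after the first visit to `far`
    by_cases hex : ∃ e, e < n ∧ far (g^[e] y)
    · obtain ⟨he, hfe⟩ := Nat.find_spec hex
      generalize hedef : Nat.find hex = e at he hfe
      have hmin : ∀ k < e, ¬ far (g^[k] y) := fun k hk hk' =>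
        Nat.find_min hex (hedef ▸ hk) ⟨hk.trans he, hk'⟩
      obtain ⟨m, rfl⟩ : ∃ m, n = e + (1 + m) := ⟨n - e - 1, by omega⟩
      rw [sum_iterate_add, sum_iterate_add]
      have h1 := hsub e y hy hmin
      have h2 := h_far _ (hT.iterate e hy) hfe
      have h3 := ih m (by omega) (g^[1] (g^[e] y)) (hT (hT.iterate e hy))
      simp only [Finset.sum_range_one, Function.iterate_zero, id]
      linarith
    · push Not at hex
      exact hsub n y hy hex

theorem sum_range_inv_pow_min_le {lam : ℝ} (hlam : 1 < lam) (b : ℕ) :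
    ∑ k ∈ Finset.range b, (lam ^ min k (b - k))⁻¹ ≤ 2 * (1 - lam⁻¹)⁻¹ := by
  have h0 : 0 < lam := by linarith
  have hr0 : 0 ≤ lam⁻¹ := by positivity
  have hr1 : lam⁻¹ < 1 := inv_lt_one_of_one_lt₀ hlam
  have hgeo : ∑ k ∈ Finset.range b, lam⁻¹ ^ k ≤ (1 - lam⁻¹)⁻¹ := by
    rw [← tsum_geometric_of_lt_one hr0 hr1]
    exact (summable_geometric_of_lt_one hr0 hr1).sum_le_tsum _ fun _ _ => by positivity
  calc ∑ k ∈ Finset.range b, (lam ^ min k (b - k))⁻¹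
      ≤ ∑ k ∈ Finset.range b, (lam⁻¹ ^ k + lam⁻¹ ^ (b - 1 - k)) := by
        refine Finset.sum_le_sum fun k hk => ?_
        have hk' := Finset.mem_range.1 hk
        rw [← inv_pow]
        rcases le_total k (b - k) with h | h
        · rw [min_eq_left h]; exact le_add_of_nonneg_right (by positivity)
        · rw [min_eq_right h]
          refine le_trans ?_ (le_add_of_nonneg_left (by positivity))
          exact pow_le_pow_of_le_one hr0 hr1.le (by omega)
    _ = 2 * ∑ k ∈ Finset.range b, lam⁻¹ ^ k := by
        rw [Finset.sum_add_distrib, Finset.sum_range_reflect (fun k => lam⁻¹ ^ k)]; ring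
    _ ≤ _ := by gcongr

/-- If the sum of `c` over a period vanishes, the sums of `c` along the periodic orbit are bounded
by those over less than a period. -/
theorem sum_periodic_le {X : Type*} {g : X → X} {c : X → ℝ} {p : X} {P : ℕ} (hP : 0 < P)
    (hp : g^[P] p = p) {E : ℝ} (hE : 0 ≤ E) (hc : ∀ k, c (g^[k] p) ≤ E)
    (h0 : ∑ k ∈ Finset.range P, c (g^[k] p) = 0) (b : ℕ) :
    ∑ k ∈ Finset.range b, c (g^[k] p) ≤ P * E := by
  induction b using Nat.strong_induction_on with
  | _ b ih =>
    rcases lt_or_ge b P with hb | hb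
    · calc ∑ k ∈ Finset.range b, c (g^[k] p) ≤ ∑ _k ∈ Finset.range b, E :=
            Finset.sum_le_sum fun k _ => hc k
        _ = b * E := by simp
        _ ≤ P * E := by gcongr
    · obtain ⟨m, rfl⟩ := Nat.exists_eq_add_of_le hb
      rw [sum_iterate_add, h0, zero_add, hp]
      exact ih m (by omega)

section Shadowing

variable {X : Type*} [MetricSpace X]

/-- An orbit which stays `δ`-close to a separated invariant set follows a single orbit of that
set. -/
theorem dist_iterate_lt_of_separated {g : X → X} {S : Set X} {Λ γ δ : ℝ}
    (hS : MapsTo g S S) (hsep : ∀ p ∈ S, ∀ q ∈ S, p ≠ q → γ ≤ dist p q)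
    (hlip : ∀ x y, dist (g x) (g y) ≤ Λ * dist x y) (hΛ : 0 ≤ Λ) (hδ : (Λ + 1) * δ ≤ γ)
    {y p : X} (hp : p ∈ S) (hyp : dist y p < δ) {b : ℕ}
    (hb : ∀ k ≤ b, ∃ q ∈ S, dist (g^[k] y) q < δ) :
    ∀ k ≤ b, dist (g^[k] y) (g^[k] p) < δ := by
  intro k
  induction k with
  | zero => intro _; exact hyp
  | succ k ih =>
    intro hk
    have h1 := ih (by omega)
    obtain ⟨q, hq, hyq⟩ := hb (k + 1) hk
    have h2 : dist (g^[k + 1] y) (g^[k + 1] p) ≤ Λ * δ := by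
      rw [Function.iterate_succ_apply', Function.iterate_succ_apply']
      exact (hlip _ _).trans (by gcongr)
    by_cases hqp : q = g^[k + 1] p
    · rwa [hqp] at hyq
    · have h3 := hsep q hq _ (hS.iterate (k + 1) hp) hqp
      have h4 := dist_triangle_left q (g^[k + 1] p) (g^[k + 1] y)
      linarith

/-- The main estimate: Birkhoff sums of `φ - A` corrected by the coboundary of `u` and penalized
by `N a √d w` are bounded above. Here `S` is a union of periodic orbits along which `φ` has
average `A`, and `w` is comparable to the distance to `S` beyond the scale `√d`. The excursion
argument applies with `near` the `√d`-neighbourhood of `S` and `far` the complement of its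
`δ₁`-neighbourhood:
* outside `near`, the coboundary inequality `hc` costs `2 N d`, which the penalty compensates;
* between two visits to `near` without reaching `far`, the orbit shadows an orbit of `S`, so that
  the hyperbolic estimate bounds the cost by a multiple of `N √d`;
* in `far` the penalty is at least a large multiple of `N √d`. -/
theorem sum_iterate_le_of_hyperbolic {g : X → X} {T S : Set X} (hT : MapsTo g T T) (hST : S ⊆ T)
    (hS : MapsTo g S S) {P : ℕ} (hP : 0 < P) (hper : ∀ p ∈ S, g^[P] p = p)
    {Λ γ δ δ₁ K lam : ℝ} (hsep : ∀ p ∈ S, ∀ q ∈ S, p ≠ q → γ ≤ dist p q)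
    (hlip : ∀ x y, dist (g x) (g y) ≤ Λ * dist x y) (hΛ : 1 ≤ Λ) (hδ₁ : (Λ + 1) * δ₁ ≤ γ)
    (hδ : δ₁ ≤ δ) (hK : 0 < K) (hlam : 1 < lam)
    (hyp : ∀ x ∈ T, ∀ y ∈ T, ∀ n : ℕ, 1 ≤ n → (∀ m ≤ n, dist (g^[m] x) (g^[m] y) < δ) →
      ∀ m ≤ n, dist (g^[m] x) (g^[m] y) ≤
        K * (lam ^ min m (n - m))⁻¹ * (dist x y + dist (g^[n] x) (g^[n] y)))
    {φ u w : X → ℝ} {N L A d κ a : ℝ} (hN : 0 ≤ N) (hL : 0 ≤ L)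
    (hφ : ∀ x y, |φ x - φ y| ≤ N * dist x y)
    (hd0 : 0 ≤ d) (hd1 : d ≤ √d) (hdδ : √d ≤ δ₁)
    (hc : ∀ y ∈ T, φ y - A + u y - u (g y) ≤ 2 * N * d)
    (hu : ∀ y ∈ T, ∀ z ∈ T, u y - u z ≤ L * N * (dist y z + 2 * d))
    (hA : ∀ p ∈ S, ∑ k ∈ Finset.range P, φ (g^[k] p) = P * A)
    (hw0 : ∀ y, 0 ≤ w y) (hw : ∀ y r, √d ≤ r → (∀ p ∈ S, r ≤ dist y p) → κ * r ≤ w y)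
    (ha0 : 0 ≤ a) (ha : 2 ≤ a * κ)
    (ha' : (4 * K * (1 - lam⁻¹)⁻¹ + 2 * P + 6 * L + 2) + 2 ≤ a * κ * δ₁) :
    ∀ n, ∀ y ∈ T, ∑ k ∈ Finset.range n,
      (φ (g^[k] y) - A + u (g^[k] y) - u (g (g^[k] y)) - N * (a * √d) * w (g^[k] y)) ≤
        N * √d * (4 * K * (1 - lam⁻¹)⁻¹ + 2 * P + 6 * L + 2) := by
  set ρ := √d with hρ
  have hρ0 : 0 ≤ ρ := Real.sqrt_nonneg d
  have hρ2 : ρ * ρ = d := Real.mul_self_sqrt hd0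
  set G := (1 - lam⁻¹)⁻¹ with hG
  have hG0 : 0 < G := inv_pos.2 (sub_pos.2 (inv_lt_one_of_one_lt₀ hlam))
  set C := 4 * K * G + 2 * P + 6 * L + 2 with hC
  have hC0 : 0 ≤ C := by positivity
  refine sum_le_of_excursions (s := fun y => φ y - A + u y - u (g y) - N * (a * ρ) * w y) hT
    (near := fun y => ∃ p ∈ S, dist y p < ρ) (far := fun y => ∀ p ∈ S, δ₁ ≤ dist y p)
    (by positivity) ?_ ?_ ?_
  · intro y hy hnear
    push Not at hnear
    have h1 := hw y ρ le_rfl hnear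
    have h2 := hc y hy
    have h3 : N * (a * ρ) * (κ * ρ) ≤ N * (a * ρ) * w y := by gcongr
    have h4 : N * d * 2 ≤ N * d * (a * κ) := by gcongr
    have h5 : N * (a * ρ) * (κ * ρ) = N * d * (a * κ) := by rw [← hρ2]; ring
    linarith
  · intro y hy hfar
    have h1 := hw y δ₁ hdδ hfar
    have h2 := hc y hy
    have h3 : N * (a * ρ) * (κ * δ₁) ≤ N * (a * ρ) * w y := by gcongr
    have h4 : N * ρ * (C + 2) ≤ N * ρ * (a * κ * δ₁) := by gcongr
    have h5 : N * d ≤ N * ρ := by gcongr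
    have h6 : N * (a * ρ) * (κ * δ₁) = N * ρ * (a * κ * δ₁) := by ring
    linarith
  · rintro y hy b ⟨p, hp, hyp0⟩ ⟨p', hp', hypb⟩ hfar
    have hnear : ∀ k ≤ b, ∃ q ∈ S, dist (g^[k] y) q < δ₁ := fun k hk => by
      have := hfar k hk; push Not at this; exact this
    have hshadow := dist_iterate_lt_of_separated hS hsep hlip (by linarith) hδ₁ hp
      (hyp0.trans_le hdδ) hnear
    have hTk (k : ℕ) : g^[k] y ∈ T := hT.iterate k hy
    have hSk (k : ℕ) : g^[k] p ∈ S := hS.iterate k hp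
    -- the point of `S` near the end of the stretch is the shadowing one
    have hend : dist (g^[b] y) (g^[b] p) < ρ := by
      by_cases hpp : p' = g^[b] p
      · rwa [← hpp]
      · have h1 := hsep p' hp' _ (hSk b) hpp
        have h2 := dist_triangle_left p' (g^[b] p) (g^[b] y)
        have h3 := hshadow b le_rfl
        have h4 : 0 ≤ δ₁ := hρ0.trans hdδ
        have h5 : 1 * δ₁ ≤ Λ * δ₁ := by gcongr
        linarith
    -- the values of `φ` along the two orbits differ by a geometrically summable amount
    have hsum : ∑ k ∈ Finset.range b, |φ (g^[k] y) - φ (g^[k] p)| ≤ N * ρ * (4 * K * G) := by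
      rcases Nat.eq_zero_or_pos b with rfl | hb
      · simp only [Finset.range_zero, Finset.sum_empty]; positivity
      · have hk (k : ℕ) (hk : k ∈ Finset.range b) : |φ (g^[k] y) - φ (g^[k] p)| ≤
            N * (K * (2 * ρ)) * (lam ^ min k (b - k))⁻¹ := by
          have h1 := hyp y hy p (hST hp) b hb (fun m hm => (hshadow m hm).trans_le hδ) k
            (Finset.mem_range.1 hk).le
          calc |φ (g^[k] y) - φ (g^[k] p)| ≤ N * dist (g^[k] y) (g^[k] p) := hφ _ _
            _ ≤ N * (K * (lam ^ min k (b - k))⁻¹ * (dist y p + dist (g^[b] y) (g^[b] p))) := by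
                gcongr
            _ ≤ N * (K * (lam ^ min k (b - k))⁻¹ * (2 * ρ)) := by gcongr; linarith
            _ = _ := by ring
        calc _ ≤ ∑ k ∈ Finset.range b, N * (K * (2 * ρ)) * (lam ^ min k (b - k))⁻¹ :=
              Finset.sum_le_sum hk
          _ ≤ N * (K * (2 * ρ)) * (2 * G) := by
              rw [← Finset.mul_sum]; gcongr; exact sum_range_inv_pow_min_le hlam b
          _ = _ := by ring
    have htel (z : X) (b : ℕ) : ∑ k ∈ Finset.range b,
        (φ (g^[k] z) - A + u (g^[k] z) - u (g (g^[k] z))) =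
        ∑ k ∈ Finset.range b, (φ (g^[k] z) - A) + (u z - u (g^[b] z)) := by
      have h1 := Finset.sum_range_sub' (fun k => u (g^[k] z)) b
      simp only [Function.iterate_zero, id, Function.iterate_succ_apply'] at h1
      rw [← h1, ← Finset.sum_add_distrib]
      exact Finset.sum_congr rfl fun k _ => by ring
    -- for the shadowing orbit the coboundary inequality is lossless over a full period
    have hbracket : ∑ k ∈ Finset.range b,
        (φ (g^[k] p) - A + u (g^[k] p) - u (g (g^[k] p))) ≤ P * (2 * N * d) := by
      refine sum_periodic_le (c := fun y => φ y - A + u y - u (g y)) hP (hper p hp)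
        (by positivity) (fun k => hc _ (hST (hSk k))) ?_ b
      rw [htel, hper p hp, Finset.sum_sub_distrib, hA p hp]
      simp
    have hdrop : ∑ k ∈ Finset.range (b + 1), (φ (g^[k] y) - A + u (g^[k] y) - u (g (g^[k] y)) -
        N * (a * ρ) * w (g^[k] y)) ≤ ∑ k ∈ Finset.range (b + 1),
        (φ (g^[k] y) - A + u (g^[k] y) - u (g (g^[k] y))) := by
      refine Finset.sum_le_sum fun k _ => sub_le_self _ ?_
      have := hw0 (g^[k] y)
      positivity
    refine hdrop.trans ?_
    rw [Finset.sum_range_succ, htel]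
    rw [htel] at hbracket
    have hlast := hc _ (hTk b)
    have hu0 := hu y hy p (hST hp)
    have hub := hu _ (hST (hSk b)) _ (hTk b)
    have hcmp : ∑ k ∈ Finset.range b, (φ (g^[k] y) - A) ≤
        ∑ k ∈ Finset.range b, (φ (g^[k] p) - A) + N * ρ * (4 * K * G) := by
      refine le_trans ?_ (add_le_add_right hsum _)
      rw [← Finset.sum_add_distrib]
      refine Finset.sum_le_sum fun k _ => ?_
      have := le_abs_self (φ (g^[k] y) - φ (g^[k] p))
      linarith
    have hNd : N * d ≤ N * ρ := by gcongr
    have hLN : 0 ≤ L * N := by positivity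
    have hu0' : u y - u p ≤ L * N * (3 * ρ) :=
      hu0.trans (by gcongr; linarith)
    have hub' : u (g^[b] p) - u (g^[b] y) ≤ L * N * (3 * ρ) := by
      refine hub.trans ?_
      rw [dist_comm]
      gcongr; linarith
    have hPd : (P : ℝ) * (2 * N * d) ≤ P * (2 * (N * ρ)) := by
      rw [mul_assoc]; gcongr
    have : N * ρ * C = N * ρ * (4 * K * G) + P * (2 * (N * ρ)) + 2 * (L * N * (3 * ρ)) +
      2 * (N * ρ) := by rw [hC]; ring
    rw [this]
    linarith

end Shadowing

/-! ### Intertwining pairs -/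

theorem Continuous.integrable_of_mem_invariantMeasures {X : Type*} [TopologicalSpace X]
    [CompactSpace X] [MeasurableSpace X] [BorelSpace X] {g : X → X} {μ : Measure X}
    (hμ : μ ∈ invariantMeasures g) {F : X → ℝ} (hF : Continuous F) : Integrable F μ := by
  have := hμ.1
  exact hF.integrable_of_hasCompactSupport (HasCompactSupport.of_compactSpace _)

theorem sum_iterate_orbit {X : Type*} {g : X → X} {y : X} {P : ℕ} (hy : g^[P] y = y) (F : X → ℝ)
    (j : ℕ) :
    ∑ k ∈ Finset.range P, F (g^[k] (g^[j] y)) = ∑ k ∈ Finset.range P, F (g^[k] y) := by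
  have h1 := sum_iterate_add g F y j P
  rw [add_comm, sum_iterate_add, hy] at h1
  linarith

section Intertwining

variable {X : Type*} [MetricSpace X] {𝓕 : Type*} [FunLike 𝓕 X X] [LipschitzSelfMapClass 𝓕 X]

theorem continuous_of_lipschitzSelfMapClass (g : 𝓕) : Continuous g :=
  (LipschitzSelfMapClass.exists_lipschitzWith (X := X) g).choose_spec.continuous

theorem dist_le_lipConst_mul_dist (g : 𝓕) (x y : X) :
    dist (g x) (g y) ≤ lipConst g * dist x y := by
  obtain ⟨K, hK⟩ := LipschitzSelfMapClass.exists_lipschitzWith (X := X) g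
  rcases eq_or_ne x y with rfl | hxy
  · simp
  rw [← div_le_iff₀ (dist_pos.2 hxy)]
  refine le_csSup ⟨K, ?_⟩ ⟨x, y, hxy, rfl⟩
  rintro _ ⟨a, b, hab, rfl⟩
  rw [div_le_iff₀ (dist_pos.2 hab)]
  exact hK.dist_le_mul a b

theorem dist_le_distToId [CompactSpace X] {A B : Set X} (h : A → B) (x : A) :
    dist (h x : X) x ≤ distToId h := by
  refine le_ciSup (f := fun x : A => dist (h x : X) (x : X)) ⟨Metric.diam (univ : Set X), ?_⟩ x
  rintro _ ⟨y, rfl⟩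
  exact Metric.dist_le_diam_of_mem isCompact_univ.isBounded trivial trivial

theorem distToId_nonneg {A B : Set X} (h : A → B) : 0 ≤ distToId h :=
  Real.iSup_nonneg fun _ => dist_nonneg

theorem mapsTo_nonwanderingSet (g : 𝓕) : MapsTo g (nonwanderingSet g) (nonwanderingSet g) :=
  fun _ hy => map_mem_nonwanderingSet (continuous_of_lipschitzSelfMapClass g) hy

theorem coe_restrictNonwandering_iterate (g : 𝓕) (y : nonwanderingSet g) (k : ℕ) :
    (((restrictNonwandering g)^[k] y : nonwanderingSet g) : X) = g^[k] y := by
  induction k generalizing y with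
  | zero => rfl
  | succ k ih => rw [Function.iterate_succ_apply, Function.iterate_succ_apply, ih]; rfl

theorem coe_intertwining_iterate {f g : 𝓕} {h : nonwanderingSet f → nonwanderingSet g}
    (hh : h ∘ restrictNonwandering f = restrictNonwandering g ∘ h) (x : nonwanderingSet f) (k : ℕ) :
    (h ((restrictNonwandering f)^[k] x) : X) = g^[k] (h x) := by
  have : Function.Semiconj h (restrictNonwandering f) (restrictNonwandering g) :=
    fun z => congrFun hh z
  rw [(this.iterate_right k).eq, coe_restrictNonwandering_iterate]

/-- An intertwining map sends the orbit of `x` to the orbit of `h x`. -/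
theorem image_orbit_eq {f g : 𝓕} {h : nonwanderingSet f → nonwanderingSet g}
    (hh : h ∘ restrictNonwandering f = restrictNonwandering g ∘ h) (x : nonwanderingSet f) :
    (fun z => (h z : X)) '' {z | (z : X) ∈ range fun k : ℕ => f^[k] (x : X)} =
      range fun k : ℕ => g^[k] (h x : X) := by
  ext y
  constructor
  · rintro ⟨z, ⟨k, hk⟩, rfl⟩
    refine ⟨k, ?_⟩
    have : z = (restrictNonwandering f)^[k] x :=
      Subtype.ext (by rw [coe_restrictNonwandering_iterate]; exact hk.symm)
    simp only [this, coe_intertwining_iterate hh]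
  · rintro ⟨k, rfl⟩
    exact ⟨(restrictNonwandering f)^[k] x, ⟨k, (coe_restrictNonwandering_iterate f x k).symm⟩,
      coe_intertwining_iterate hh x k⟩

theorem iterate_intertwining_eq {f g : 𝓕} {h : nonwanderingSet f → nonwanderingSet g}
    (hh : h ∘ restrictNonwandering f = restrictNonwandering g ∘ h) {x : nonwanderingSet f} {P : ℕ}
    (hx : f^[P] (x : X) = x) : g^[P] (h x : X) = h x := by
  rw [← coe_intertwining_iterate hh]
  congr 1
  exact congrArg h (Subtype.ext (by rw [coe_restrictNonwandering_iterate]; exact hx))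

theorem dist_iterate_intertwining_le [CompactSpace X] {f g : 𝓕}
    {h : nonwanderingSet f → nonwanderingSet g}
    (hh : h ∘ restrictNonwandering f = restrictNonwandering g ∘ h) (x : nonwanderingSet f) (k : ℕ) :
    dist (g^[k] (h x : X)) (f^[k] (x : X)) ≤ distToId h := by
  rw [← coe_intertwining_iterate hh, ← coe_restrictNonwandering_iterate]
  exact dist_le_distToId h _

/-- If `h` is close to the identity, the image of a separated orbit is separated. -/
theorem le_dist_iterate_intertwining [CompactSpace X] {f g : 𝓕}
    {h : nonwanderingSet f → nonwanderingSet g}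
    (hh : h ∘ restrictNonwandering f = restrictNonwandering g ∘ h) (x : nonwanderingSet f) {P : ℕ}
    {γ : ℝ} (hγ : ∀ k < P, ∀ l < P, k ≠ l → γ ≤ dist (f^[k] (x : X)) (f^[l] (x : X)))
    (hd : distToId h ≤ γ / 4) :
    ∀ k < P, ∀ l < P, k ≠ l → γ / 2 ≤ dist (g^[k] (h x : X)) (g^[l] (h x : X)) := by
  intro k hk l hl hkl
  have h1 := hγ k hk l hl hkl
  have h2 := dist_iterate_intertwining_le hh x k
  have h3 := dist_iterate_intertwining_le hh x l
  have h4 := dist_triangle4_left (g^[k] (h x : X)) (g^[l] (h x : X)) (f^[k] (x : X)) (f^[l] (x : X))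
  linarith

variable [CompactSpace X] [MeasurableSpace X] [BorelSpace X]

/-- The penalized integral of `φ` against any `g`-invariant measure is at most the average of `φ`
over the orbit `h(O)`, where the orbit `O` of `x` is `(f, φ)`-maximizing. The sub-action `u` for
`f` is carried to `Ω(g)` by `i`; as `i` intertwines, this only loses `N d` in the coboundary
inequality. -/
theorem integral_sub_le_of_intertwining {f g : 𝓕} {h : nonwanderingSet f → nonwanderingSet g}
    {i : nonwanderingSet g → nonwanderingSet f}
    (hh : h ∘ restrictNonwandering f = restrictNonwandering g ∘ h)
    (hi : i ∘ restrictNonwandering g = restrictNonwandering f ∘ i) {d : ℝ}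
    (hd : max (distToId h) (distToId i) = d) (x : nonwanderingSet f) {P : ℕ} (hP : 0 < P)
    (hx : f^[P] (x : X) = x)
    {Λ γ δ δ₁ K lam : ℝ}
    (hsep : ∀ k < P, ∀ l < P, k ≠ l → γ ≤ dist (g^[k] (h x : X)) (g^[l] (h x : X)))
    (hlip : ∀ x y, dist (g x) (g y) ≤ Λ * dist x y) (hΛ : 1 ≤ Λ) (hδ₁ : (Λ + 1) * δ₁ ≤ γ)
    (hδ : δ₁ ≤ δ) (hK : 0 < K) (hlam : 1 < lam)
    (hyp : ∀ x ∈ nonwanderingSet g, ∀ y ∈ nonwanderingSet g, ∀ n : ℕ, 1 ≤ n →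
      (∀ m ≤ n, dist (g^[m] x) (g^[m] y) < δ) → ∀ m ≤ n, dist (g^[m] x) (g^[m] y) ≤
        K * (lam ^ min m (n - m))⁻¹ * (dist x y + dist (g^[n] x) (g^[n] y)))
    {φ w : X → ℝ} {u : nonwanderingSet f → ℝ} {N L κ a : ℝ} (hN : 0 ≤ N) (hL : 0 ≤ L)
    (hφc : Continuous φ) (hwc : Continuous w)
    (hφ : ∀ x y, |φ x - φ y| ≤ N * dist x y)
    (hφQ : maxErgodicAverage f φ = (P : ℝ)⁻¹ * ∑ k ∈ Finset.range P, φ (f^[k] (x : X)))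
    (hu : ∀ y z, |u y - u z| ≤ L * N * dist y z)
    (hmane : ∀ y : nonwanderingSet f, φ y + u y - u (restrictNonwandering f y) ≤
      maxErgodicAverage f φ)
    (hd1 : d ≤ √d) (hdδ : √d ≤ δ₁)
    (hw0 : ∀ y, 0 ≤ w y)
    (hw : ∀ y r, √d ≤ r → (∀ k < P, r ≤ dist y (g^[k] (h x : X))) → κ * r ≤ w y)
    (ha0 : 0 ≤ a) (ha : 2 ≤ a * κ)
    (ha' : (4 * K * (1 - lam⁻¹)⁻¹ + 2 * P + 6 * L + 2) + 2 ≤ a * κ * δ₁)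
    {μ : Measure X} (hμ : μ ∈ invariantMeasures g) :
    ∫ y, φ y ∂μ - N * (a * √d) * ∫ y, w y ∂μ ≤
      (P : ℝ)⁻¹ * ∑ k ∈ Finset.range P, φ (g^[k] (h x : X)) := by
  classical
  have := hμ.1
  set y₀ : X := (h x : X) with hy₀
  have hgper : g^[P] y₀ = y₀ := iterate_intertwining_eq hh hx
  have hP' : (0 : ℝ) < P := by exact_mod_cast hP
  set A := (P : ℝ)⁻¹ * ∑ k ∈ Finset.range P, φ (g^[k] y₀) with hA
  set S : Set X := range fun k : ℕ => g^[k] y₀ with hS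
  have hSimage := range_iterate_eq_image_range hP hgper
  have hSlt {p : X} (hp : p ∈ S) : ∃ k < P, g^[k] y₀ = p := by
    rw [hS, hSimage] at hp
    obtain ⟨k, hk, rfl⟩ := hp
    exact ⟨k, by simpa using hk, rfl⟩
  have hdh : distToId h ≤ d := hd ▸ le_max_left _ _
  have hdi : distToId i ≤ d := hd ▸ le_max_right _ _
  have hd0 : 0 ≤ d := (distToId_nonneg h).trans hdh
  have hQA : maxErgodicAverage f φ - N * d ≤ A := by
    rw [hφQ, hA, sub_le_iff_le_add]
    calc (P : ℝ)⁻¹ * ∑ k ∈ Finset.range P, φ (f^[k] (x : X))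
        ≤ (P : ℝ)⁻¹ * ∑ k ∈ Finset.range P, (φ (g^[k] y₀) + N * d) := by
          gcongr with k
          have h1 := (neg_le_abs _).trans (hφ (g^[k] y₀) (f^[k] (x : X)))
          have h2 : N * dist (g^[k] y₀) (f^[k] (x : X)) ≤ N * d := by
            gcongr; exact (dist_iterate_intertwining_le hh x k).trans hdh
          linarith
      _ = _ := by
          rw [Finset.sum_add_distrib, Finset.sum_const, Finset.card_range, nsmul_eq_mul]
          field_simp
  -- the transported sub-action, with an irrelevant value off `Ω(g)`
  let v : X → ℝ := fun y => if hy : y ∈ nonwanderingSet g then u (i ⟨y, hy⟩) else 0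
  have hv (y : X) (hy : y ∈ nonwanderingSet g) : v y = u (i ⟨y, hy⟩) := dif_pos hy
  have hdist_i (y : nonwanderingSet g) : dist (i y : X) y ≤ d := (dist_le_distToId i y).trans hdi
  have hvg (y : X) (hy : y ∈ nonwanderingSet g) :
      v (g y) = u (restrictNonwandering f (i ⟨y, hy⟩)) := by
    rw [hv _ (mapsTo_nonwanderingSet g hy)]
    exact congrArg u (congrFun hi ⟨y, hy⟩)
  have hvdist (y : X) (hy : y ∈ nonwanderingSet g) (z : X) (hz : z ∈ nonwanderingSet g) :
      v y - v z ≤ L * N * (dist y z + 2 * d) := by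
    rw [hv y hy, hv z hz]
    refine (le_abs_self _).trans ((hu _ _).trans ?_)
    gcongr
    have h1 := hdist_i ⟨y, hy⟩
    have h2 := hdist_i ⟨z, hz⟩
    have h3 := dist_triangle4_right (i ⟨y, hy⟩ : X) (i ⟨z, hz⟩ : X) y z
    rw [Subtype.dist_eq]
    linarith
  have key := sum_iterate_le_of_hyperbolic (g := g) (T := nonwanderingSet g) (S := S) (φ := φ)
    (u := v) (w := w) (A := A) (mapsTo_nonwanderingSet g) ?_ ?_ hP ?_ ?_ hlip hΛ hδ₁ hδ hK hlam hyp
    hN hL hφ hd0 hd1 hdδ ?_ hvdist ?_ hw0 ?_ ha0 ha ha'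
  rotate_left
  · rintro _ ⟨k, rfl⟩
    exact (mapsTo_nonwanderingSet g).iterate k (h x).2
  · rintro _ ⟨k, rfl⟩
    exact ⟨k + 1, Function.iterate_succ_apply' _ _ _⟩
  · rintro _ ⟨k, rfl⟩
    simp only
    rw [← Function.iterate_add_apply, add_comm, Function.iterate_add_apply, hgper]
  · intro p hp q hq hpq
    obtain ⟨k, hk, rfl⟩ := hSlt hp
    obtain ⟨l, hl, rfl⟩ := hSlt hq
    exact hsep k hk l hl fun hkl => hpq (by rw [hkl])
  · intro y hy
    rw [hv y hy, hvg y hy]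
    have h1 := hmane (i ⟨y, hy⟩)
    have h2 := (le_abs_self _).trans (hφ y (i ⟨y, hy⟩))
    have h3 : N * dist y (i ⟨y, hy⟩ : X) ≤ N * d := by
      gcongr; rw [dist_comm]; exact hdist_i ⟨y, hy⟩
    linarith
  · rintro _ ⟨k, rfl⟩
    simp only
    rw [sum_iterate_orbit hgper, hA]
    field_simp
  · intro y r hr hS
    exact hw y r hr fun k _ => hS _ ⟨k, rfl⟩
  have hint := integral_nonpos_of_sum_le (g := g) (T := nonwanderingSet g)
    (Φ := fun y => φ y - A - N * (a * √d) * w y) (C := N * √d *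
      (4 * K * (1 - lam⁻¹)⁻¹ + 2 * P + 6 * L + 2) +
      L * N * (Metric.diam (univ : Set X) + 2 * d)) ?_ hμ (ae_mem_nonwanderingSet hμ)
    (((hφc.sub continuous_const).sub (continuous_const.mul hwc)).integrable_of_mem_invariantMeasures
      hμ)
  · have hφi := hφc.integrable_of_mem_invariantMeasures hμ
    have hwi := hwc.integrable_of_mem_invariantMeasures hμ
    have hφA : Integrable (fun y => φ y - A) μ := hφi.sub (integrable_const A)
    rw [integral_sub hφA (hwi.const_mul _),
      integral_sub hφi (integrable_const _), integral_const_mul (N * (a * √d)) w,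
      integral_const] at hint
    simp only [probReal_univ, one_smul] at hint
    linarith
  · intro y hy n
    have h1 := key n y hy
    have h2 := Finset.sum_range_sub' (fun k => v (g^[k] y)) n
    simp only [Function.iterate_zero, id, Function.iterate_succ_apply'] at h2
    have h3 := hvdist _ ((mapsTo_nonwanderingSet g).iterate n hy) y hy
    have h4 : L * N * (dist (g^[n] y) y + 2 * d) ≤
        L * N * (Metric.diam (univ : Set X) + 2 * d) := by
      gcongr
      exact Metric.dist_le_diam_of_mem isCompact_univ.isBounded trivial trivial
    have h5 : ∑ k ∈ Finset.range n, (φ (g^[k] y) - A - N * (a * √d) * w (g^[k] y)) =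
        ∑ k ∈ Finset.range n, (φ (g^[k] y) - A + v (g^[k] y) - v (g (g^[k] y)) -
          N * (a * √d) * w (g^[k] y)) - ∑ k ∈ Finset.range n, (v (g^[k] y) - v (g (g^[k] y))) := by
      rw [← Finset.sum_sub_distrib]
      exact Finset.sum_congr rfl fun k _ => by ring
    rw [h5, h2]
    linarith

/-- Invariant measures only depend on the restriction of the map to its nonwandering set. -/
theorem invariantMeasures_eq_of_eqOn {f g : 𝓕} (hΩ : nonwanderingSet f = nonwanderingSet g)
    (hfg : EqOn f g (nonwanderingSet f)) : invariantMeasures f = invariantMeasures g := by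
  have aux (f g : 𝓕) (hfg : EqOn f g (nonwanderingSet f)) :
      invariantMeasures f ⊆ invariantMeasures g := by
    rintro μ hμ
    refine ⟨hμ.1, (continuous_of_lipschitzSelfMapClass g).measurable, ?_⟩
    rw [← Measure.map_congr ((ae_mem_nonwanderingSet hμ).mono fun y hy => hfg hy), hμ.2.map_eq]
  exact (aux f g hfg).antisymm (aux g f (hΩ ▸ hfg.symm))

end Intertwining

/-! ### Perturbation of a maximizing periodic orbit -/

theorem exists_pos_forall_le_of_injOn {X : Type*} [MetricSpace X] {y : ℕ → X} {P : ℕ}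
    (hinj : InjOn y (Finset.range P : Set ℕ)) :
    ∃ γ : ℝ, 0 < γ ∧ ∀ k < P, ∀ l < P, k ≠ l → γ ≤ dist (y k) (y l) := by
  have h : ∀ᶠ γ in 𝓝[>] (0 : ℝ), ∀ q ∈ Finset.range P ×ˢ Finset.range P, q.1 ≠ q.2 →
      γ ≤ dist (y q.1) (y q.2) := by
    refine (eventually_all_finset _).2 fun q hq => ?_
    obtain ⟨h1, h2⟩ := Finset.mem_product.1 hq
    rw [eventually_imp_distrib_left]
    intro hne
    exact nhdsWithin_le_nhds (ge_mem_nhds (dist_pos.2 (hinj.ne h1 h2 hne)))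
  obtain ⟨γ, h1, h2⟩ := (h.and self_mem_nhdsWithin).exists
  exact ⟨γ, h2, fun k hk l hl => h1 (k, l)
    (Finset.mem_product.2 ⟨Finset.mem_range.2 hk, Finset.mem_range.2 hl⟩)⟩

/-- The Mañé lemma in the Lipschitz case `α = 1`, stated with Lipschitz bounds. -/
theorem ManeLemma.exists_lipschitz {X : Type*} [MetricSpace X] [MeasurableSpace X] {𝓕 : Type*}
    [FunLike 𝓕 X X] [LipschitzSelfMapClass 𝓕 X] [TopologicalSpace 𝓕] {f : 𝓕} (hf : ManeLemma f) :
    ∃ L : ℝ, 0 ≤ L ∧ ∀ (N : ℝ) (φ : X → ℝ), 0 ≤ N → (∀ x y, |φ x - φ y| ≤ N * dist x y) →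
      ∃ u : nonwanderingSet f → ℝ, (∀ y z, |u y - u z| ≤ L * N * dist y z) ∧
        ∀ y : nonwanderingSet f,
          φ y + u y - u (restrictNonwandering f y) ≤ maxErgodicAverage f φ := by
  obtain ⟨L, -, h⟩ := hf 1 one_pos le_rfl
  refine ⟨L, L.2, fun N φ hN hφ => ?_⟩
  lift N to ℝ≥0 using hN
  have hφ' : HolderWith N 1 φ := holderWith_one.2 (LipschitzWith.of_dist_le_mul hφ)
  obtain ⟨u, hu, hu1, hu2⟩ := h φ hφ'.memHolder
  refine ⟨u, fun y z => ?_, hu1⟩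
  have h1 := (holderWith_one.1 hu.holderWith).dist_le_mul y z
  rw [Real.dist_eq] at h1
  refine h1.trans ?_
  gcongr
  exact_mod_cast hu2.trans (mul_le_mul_right hφ'.nnholderNorm_le L)

theorem integral_eq_of_forall_eq {X : Type*} [MeasurableSpace X] {φ : X → ℝ}
    (h : ∀ x y, φ x = φ y) (x : X) {μ : Measure X} [IsProbabilityMeasure μ] :
    ∫ y, φ y ∂μ = φ x := by
  simp [h _ x]

theorem mainTheorem8 {n : ℕ} {M : Type*} [MetricSpace M] [CompactSpace M]
    [MeasurableSpace M] [BorelSpace M]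
    [ChartedSpace (EuclideanSpace ℝ (Fin n)) M] [IsManifold (𝓡 n) ∞ M]
    [RiemannianBundle (fun x : M => TangentSpace (𝓡 n) x)]
    [IsContMDiffRiemannianBundle (𝓡 n) ∞ (EuclideanSpace ℝ (Fin n))
      (fun x : M => TangentSpace (𝓡 n) x)]
    [IsRiemannianManifold (𝓡 n) M]
    {𝓕 : Type*} [TopologicalSpace 𝓕] [FunLike 𝓕 M M] [LipschitzSelfMapClass 𝓕 M]
    (f : 𝓕) (hf : StablyHyperbolic f) (O : Set M) (hO : IsPeriodicOrbit f O) :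
    ∃ U ∈ 𝓝 f, ∃ C : ℝ, 0 < C ∧ ∃ ε : ℝ, 0 < ε ∧ ∀ g ∈ U,
      (∃ (h : nonwanderingSet f → nonwanderingSet g) (i : nonwanderingSet g → nonwanderingSet f),
        IsIntertwining f g ε h i) ∧
      ∀ (h : nonwanderingSet f → nonwanderingSet g) (i : nonwanderingSet g → nonwanderingSet f),
        IsIntertwining f g ε h i →
        ∃ v : M → ℝ, ContMDiff (𝓡 n) 𝓘(ℝ, ℝ) 1 v ∧
          supNormDeriv (n := n) v ≤ 3 * C * √(max (distToId h) (distToId i)) ∧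
          orbitMeasure ((fun x => (h x : M)) '' {x | (x : M) ∈ O}) ∈ maximizingMeasures g v ∧
          ∀ φ : M → ℝ, ContMDiff (𝓡 n) 𝓘(ℝ, ℝ) 1 φ →
            maximizingMeasures f φ = {orbitMeasure O} →
            maximizingMeasures g (fun x => φ x + supNormDeriv (n := n) φ * v x) =
              {orbitMeasure ((fun x => (h x : M)) '' {x | (x : M) ∈ O})} := by
  classical
  obtain ⟨x₀, P, hP, hx, hinj, rfl⟩ := hO.exists_injOn
  have : Nonempty M := ⟨x₀⟩
  lift x₀ to nonwanderingSet f using mem_nonwanderingSet_of_iterate_eq hP hx with x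
  obtain ⟨γ, hγ, hsepf⟩ := exists_pos_forall_le_of_injOn hinj
  obtain ⟨L, hL, hmane⟩ := hf.maneLemma.exists_lipschitz
  obtain ⟨U₂, hU₂, K, δ, lam, hK, hδ, hlam, hyp⟩ := hf.robustHyperbolicEstimates
  obtain ⟨B, κ, hB, hκ, hsoft⟩ := exists_contMDiff_softDist (n := n) (M := M) P (half_pos hγ)
  have hG : 0 < (1 - lam⁻¹)⁻¹ := inv_pos.2 (sub_pos.2 (inv_lt_one_of_one_lt₀ hlam))
  obtain ⟨C₀, hC₀⟩ : ∃ C₀, C₀ = 4 * K * (1 - lam⁻¹)⁻¹ + 2 * P + 6 * L + 2 := ⟨_, rfl⟩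
  have hC₀pos : 0 < C₀ := by rw [hC₀]; positivity
  obtain ⟨Λ, hΛ⟩ : ∃ Λ, Λ = max 1 (2 * lipConst f) := ⟨_, rfl⟩
  have hΛ1 : 1 ≤ Λ := hΛ ▸ le_max_left _ _
  obtain ⟨δ₁, hδ₁⟩ : ∃ δ₁, δ₁ = min δ (γ / 2 / (Λ + 1)) := ⟨_, rfl⟩
  have hδ₁pos : 0 < δ₁ := by rw [hδ₁]; positivity
  have hδ₁δ : δ₁ ≤ δ := hδ₁ ▸ min_le_left _ _
  have hδ₁γ : (Λ + 1) * δ₁ ≤ γ / 2 := by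
    rw [mul_comm, ← le_div_iff₀ (by positivity), hδ₁]; exact min_le_right _ _
  -- the penalty constant: large enough to pay each step away from the orbit and each excursion
  obtain ⟨a, ha⟩ : ∃ a, a = 2 / κ + (C₀ + 2) / (κ * δ₁) := ⟨_, rfl⟩
  have hapos : 0 < a := by rw [ha]; positivity
  have ha1 : 2 ≤ a * κ := by
    have h1 : a * κ = 2 + (C₀ + 2) / δ₁ := by rw [ha]; field_simp
    rw [h1]; exact le_add_of_nonneg_right (by positivity)
  have ha2 : C₀ + 2 ≤ a * κ * δ₁ := by
    have h1 : a * κ * δ₁ = 2 * δ₁ + (C₀ + 2) := by rw [ha]; field_simp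
    rw [h1]; exact le_add_of_nonneg_left (by positivity)
  -- `r` bounds `√d`; the bound `1 / (B a + 1)` makes the penalty have derivative less than `1`
  obtain ⟨r, hr⟩ : ∃ r, r = min 1 (min δ₁ (1 / (B * a + 1))) := ⟨_, rfl⟩
  have hrpos : 0 < r := by rw [hr]; positivity
  obtain ⟨U₁, hU₁, hint⟩ := hf.intertwiningStable (min (γ / 4) (r ^ 2)) (by positivity)
  refine ⟨U₁ ∩ U₂, inter_mem hU₁ hU₂, 2 * a * B / 3, by positivity, min (γ / 4) (r ^ 2),
    by positivity, fun g hg => ⟨(hint g hg.1).2, fun h i hhi => ?_⟩⟩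
  obtain ⟨d, hd⟩ : ∃ d, max (distToId h) (distToId i) = d := ⟨_, rfl⟩
  have hdh : distToId h ≤ d := hd ▸ le_max_left _ _
  have hdi : distToId i ≤ d := hd ▸ le_max_right _ _
  have hd0 : 0 ≤ d := (distToId_nonneg h).trans hdh
  have hdε : d < min (γ / 4) (r ^ 2) := hd ▸ max_lt hhi.dist_h hhi.dist_i
  have hdr : √d < r := (Real.sqrt_lt' hrpos).2 (hdε.trans_le (min_le_right _ _))
  have hd1 : √d ≤ 1 := hdr.le.trans (hr ▸ min_le_left _ _)
  have hdδ : √d ≤ δ₁ := hdr.le.trans (hr ▸ (min_le_right _ _).trans (min_le_left _ _))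
  have hdB : B * (a * √d) < 1 := by
    have h1 : √d < 1 / (B * a + 1) :=
      hdr.trans_le (hr ▸ (min_le_right _ _).trans (min_le_right _ _))
    rw [lt_div_iff₀ (by positivity)] at h1
    linarith [Real.sqrt_nonneg d]
  have hdd : d ≤ √d := by
    conv_lhs => rw [← Real.mul_self_sqrt hd0]
    exact mul_le_of_le_one_left (Real.sqrt_nonneg d) hd1
  have hsep := le_dist_iterate_intertwining hhi.comp_h x hsepf
    (hdh.trans (hdε.le.trans (min_le_left _ _)))
  have hgx : g^[P] (h x : M) = h x := iterate_intertwining_eq hhi.comp_h hx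
  have hginj : InjOn (fun k => g^[k] (h x : M)) (Finset.range P : Set ℕ) := by
    intro k hk l hl hkl
    by_contra hne
    have h1 := hsep k (by simpa using hk) l (by simpa using hl) hne
    rw [show g^[k] (h x : M) = g^[l] (h x : M) from hkl, dist_self] at h1
    linarith
  have hgc : Continuous g := continuous_of_lipschitzSelfMapClass g
  rw [hd, image_orbit_eq hhi.comp_h]
  have hμ₀ := orbitMeasure_mem_invariantMeasures hgc.measurable hP hgx hginj
  have hμf := orbitMeasure_mem_invariantMeasures
    (continuous_of_lipschitzSelfMapClass f).measurable hP hx hinj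
  have hμ₀int := integral_orbitMeasure hP hgx hginj
  set μ₀ := orbitMeasure (range fun k : ℕ => g^[k] (h x : M)) with hμ₀def
  rcases hd0.eq_or_lt with hdzero | hdpos
  · -- both maps are the identity, so `f` and `g` have the same invariant measures and `v = 0` works
    have hh (z : nonwanderingSet f) : (h z : M) = z :=
      dist_le_zero.1 ((dist_le_distToId h z).trans (hdh.trans hdzero.ge))
    have hi (z : nonwanderingSet g) : (i z : M) = z :=
      dist_le_zero.1 ((dist_le_distToId i z).trans (hdi.trans hdzero.ge))
    have hΩ : nonwanderingSet f = nonwanderingSet g :=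
      subset_antisymm (fun z hz => by have := (h ⟨z, hz⟩).2; rwa [hh] at this)
        (fun z hz => by have := (i ⟨z, hz⟩).2; rwa [hi] at this)
    have hfg : EqOn f g (nonwanderingSet f) := fun z hz => by
      have h1 := hh (restrictNonwandering f ⟨z, hz⟩)
      have h2 : (h (restrictNonwandering f ⟨z, hz⟩) : M) = g (h ⟨z, hz⟩) :=
        congrArg Subtype.val (congrFun hhi.comp_h ⟨z, hz⟩)
      rw [h2, hh] at h1
      exact h1.symm
    have hinv := invariantMeasures_eq_of_eqOn hΩ hfg
    have horb : (fun k : ℕ => g^[k] (h x : M)) = fun k : ℕ => f^[k] (x : M) := funext fun k =>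
      dist_le_zero.1 ((dist_iterate_intertwining_le hhi.comp_h x k).trans (hdh.trans hdzero.ge))
    refine ⟨fun _ => 0, contMDiff_const, ?_, mem_maximizingMeasures hμ₀ (by simp), ?_⟩
    · refine (ciSup_le fun y => norm_mfderiv_le_of_apply_le le_rfl fun ξ => ?_).trans
        (by positivity)
      rw [mfderiv_const, zero_mul]
      exact norm_zero.le
    · intro φ _ hmax
      simp only [mul_zero, add_zero]
      rw [hμ₀def, horb, ← hmax]
      simp only [maximizingMeasures, maxErgodicAverage, hinv]
  obtain ⟨w, hw, hw0, hwS, hwB, hwlow⟩ := hsoft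
    ((Finset.range P).image fun k => g^[k] (h x : M))
    ⟨_, Finset.mem_image_of_mem _ (Finset.mem_range.2 hP)⟩
    (Finset.card_image_le.trans (Finset.card_range P).le)
    (by
      intro p hp q hq hpq
      obtain ⟨k, hk, rfl⟩ := Finset.mem_image.1 hp
      obtain ⟨l, hl, rfl⟩ := Finset.mem_image.1 hq
      exact hsep k (Finset.mem_range.1 hk) l (Finset.mem_range.1 hl) fun hkl => hpq (by rw [hkl]))
    (√d) (Real.sqrt_pos.2 hdpos)
  have hwμ₀ : ∫ y, w y ∂μ₀ = 0 := by
    rw [hμ₀int, Finset.sum_eq_zero fun k hk => (hwS _).2 (Finset.mem_image_of_mem _ hk), mul_zero]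
  have hwint {μ : Measure M} (hμ : μ ∈ invariantMeasures g) : Integrable w μ :=
    hw.continuous.integrable_of_mem_invariantMeasures hμ
  have hwnn (μ : Measure M) : 0 ≤ ∫ y, w y ∂μ := integral_nonneg hw0
  have huniq {μ : Measure M} (hμ : μ ∈ invariantMeasures g) (hle : ∫ y, w y ∂μ ≤ 0) :
      μ = μ₀ := by
    refine eq_orbitMeasure_of_measure_compl_eq_zero hP hgx hginj hμ ?_
    have h1 := (integral_eq_zero_iff_of_nonneg hw0 (hwint hμ)).1 (hle.antisymm (hwnn μ))
    refine measure_mono_null ?_ h1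
    intro y hy hwy
    obtain ⟨k, -, rfl⟩ := Finset.mem_image.1 ((hwS y).1 hwy)
    exact hy ⟨k, rfl⟩
  -- the estimate on which both uniqueness statements rest
  have key (φ : M → ℝ) (hφ : ContMDiff (𝓡 n) 𝓘(ℝ, ℝ) 1 φ)
      (hmax : maximizingMeasures f φ = {orbitMeasure (range fun k : ℕ => f^[k] (x : M))})
      {μ : Measure M} (hμ : μ ∈ invariantMeasures g) :
      ∫ y, φ y ∂μ - supNormDeriv (n := n) φ * (a * √d) * ∫ y, w y ∂μ ≤ ∫ y, φ y ∂μ₀ := by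
    obtain ⟨u, hu, hu'⟩ := hmane _ φ (supNormDeriv_nonneg (n := n) φ)
      (abs_sub_le_supNormDeriv_mul_dist hφ)
    have hQ : orbitMeasure (range fun k : ℕ => f^[k] (x : M)) ∈ maximizingMeasures f φ := by
      rw [hmax]; rfl
    rw [hμ₀int]
    refine integral_sub_le_of_intertwining hhi.comp_h hhi.comp_i hd x hP hx hsep (Λ := Λ) ?_ hΛ1
      hδ₁γ hδ₁δ hK hlam (hyp g hg.2) (supNormDeriv_nonneg φ) hL hφ.continuous hw.continuous
      (abs_sub_le_supNormDeriv_mul_dist hφ) ?_ hu hu' hdd hdδ hw0 ?_ hapos.le ha1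
      (hC₀ ▸ ha2) hμ
    · intro y z
      refine (dist_le_lipConst_mul_dist g y z).trans ?_
      gcongr
      exact (hint g hg.1).1.le.trans (hΛ ▸ le_max_right _ _)
    · rw [← hQ.2, integral_orbitMeasure hP hx hinj]
    · intro y s hs hsS
      refine hwlow y s hs fun p hp => ?_
      obtain ⟨k, hk, rfl⟩ := Finset.mem_image.1 hp
      exact hsS k (Finset.mem_range.1 hk)
  have hvint (μ : Measure M) : ∫ y, -(2 * (a * √d)) * w y ∂μ = -(2 * (a * √d)) * ∫ y, w y ∂μ :=
    integral_const_mul _ _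
  have haρ : 0 < a * √d := mul_pos hapos (Real.sqrt_pos.2 hdpos)
  refine ⟨fun y => -(2 * (a * √d)) * w y, contMDiff_const.mul hw, ?_, ?_, ?_⟩
  · refine ciSup_le fun y => (norm_mfderiv_const_mul_le hw _ y).trans ?_
    rw [abs_neg, abs_of_pos (by positivity)]
    calc 2 * (a * √d) * _ ≤ 2 * (a * √d) * B := by gcongr; exact hwB y
      _ = _ := by ring
  · refine mem_maximizingMeasures hμ₀ fun μ _ => ?_
    rw [hvint, hvint, hwμ₀, mul_zero]
    have := hwnn μ
    nlinarith
  · intro φ hφ hmax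
    have hNφ := supNormDeriv_nonneg (n := n) φ
    rcases hNφ.eq_or_lt with hN | hN
    · -- `φ` is constant, so `f` is uniquely ergodic; the estimate for `w` itself, whose
      -- derivative is bounded by `B`, then shows that `g` is uniquely ergodic
      have hconst (y z : M) : φ y = φ z := by
        have h1 := abs_sub_le_supNormDeriv_mul_dist hφ y z
        rw [← hN, zero_mul] at h1
        exact sub_eq_zero.1 (abs_nonpos_iff.1 h1)
      have hfuniq : ∀ μ ∈ invariantMeasures f,
          μ = orbitMeasure (range fun k : ℕ => f^[k] (x : M)) := by
        intro μ hμ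
        have h1 : μ ∈ maximizingMeasures f φ := by
          have := hμ.1
          have := hμf.1
          have hQ : orbitMeasure (range fun k : ℕ => f^[k] (x : M)) ∈ maximizingMeasures f φ := by
            rw [hmax]; rfl
          refine ⟨hμ, ?_⟩
          rw [← hQ.2, integral_eq_of_forall_eq hconst x, integral_eq_of_forall_eq hconst x]
        rwa [hmax] at h1
      have hguniq : ∀ μ ∈ invariantMeasures g, μ = μ₀ := by
        intro μ hμ
        refine huniq hμ ?_
        have h1 := key w hw (maximizingMeasures_eq_singleton hμf
          (fun ν hν => by rw [hfuniq ν hν]) fun ν hν _ => hfuniq ν hν) hμ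
        rw [hwμ₀] at h1
        have h2 : supNormDeriv (n := n) w ≤ B := ciSup_le hwB
        have h3 : supNormDeriv (n := n) w * (a * √d) < 1 :=
          lt_of_le_of_lt (by gcongr) hdB
        have h4 := hwnn μ
        nlinarith
      exact maximizingMeasures_eq_singleton hμ₀ (fun μ hμ => by rw [hguniq μ hμ])
        fun μ hμ _ => hguniq μ hμ
    · have hsum {μ : Measure M} (hμ : μ ∈ invariantMeasures g) :
          ∫ y, (φ y + supNormDeriv (n := n) φ * (-(2 * (a * √d)) * w y)) ∂μ =
            ∫ y, φ y ∂μ - 2 * (supNormDeriv (n := n) φ * (a * √d) * ∫ y, w y ∂μ) := by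
        rw [integral_add (hφ.continuous.integrable_of_mem_invariantMeasures hμ)
          (((hwint hμ).const_mul _).const_mul _), integral_const_mul, integral_const_mul]
        ring
      have hpos : 0 < supNormDeriv (n := n) φ * (a * √d) := by positivity
      refine maximizingMeasures_eq_singleton hμ₀ (fun μ hμ => ?_) fun μ hμ heq => huniq hμ ?_
      · rw [hsum hμ, hsum hμ₀, hwμ₀]
        have h1 := key φ hφ hmax hμ
        have h2 := mul_nonneg hpos.le (hwnn μ)
        linarith
      · rw [hsum hμ, hsum hμ₀, hwμ₀] at heq
        have h1 := key φ hφ hmax hμ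
        by_contra! h2
        have h3 := mul_pos hpos h2
        linarith
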